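/- **Setting.** Let $n$ be the number of vehicles; all indices $i,j$ range over $1,\dots,n$. Let $0<R_{in}<R_{out}$, $v_{\max}>0$, $\omega^*\in(0,v_{\max}/R_{out})$, $\Theta\in(0,\pi/2)$ with $\cos\Theta>R_{out}\omega^*/v_{\max}$, $\sigma_i>0$, $p_{i,j}=p_{j,i}>0$, $L_{i,j}=L_{j,i}>0$ ($i\ne j$), $\lambda>0$ with $\lambda>L_{i,j}$ for all $i\neq j$, $A>0$, $b>1/R_{in}^2$, $\mu_1,\mu_2>0$. For $i\neq j$ let $V_{i,j}:(L_{i,j},\infty)\to[0,\infty)$ be $C^2$ and $\kappa_{i,j}:(L_{i,j},\infty)\to[0,\infty)$ be $C^1$, with $V_{i,j}=V_{j,i}$, $\kappa_{i,j}=\kappa_{j,i}$, $V_{i,j}(d)=\kappa_{i,j}(d)=0$ for $d\ge\lambda$ and $V_{i,j}(d)\to+\infty$ as $d\to L_{i,j}^+$. Let $U_i:(R_{in},R_{out})\to[0,\infty)$ be $C^2$ with $U_i(r)\to+\infty$ as $r\to R_{in}^+$ and as $r\to R_{out}^-$. Let $g_1,g_2:\mathbb R\to\mathbb R$ be $C^1$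 and non-decreasing, and let $f:\mathbb R\to[0,\infty)$ be $C^1$ with $f(x)\ge\max(0,x)$ for all $x$. For a state $w=(r_i,\varphi_i,s_i,v_i)_{i=1}^n\in\mathbb R^{4n}$ put $d_{i,j}=\sqrt{p_{i,j}(r_i-r_j)^2+2r_ir_j(1-\cos(\varphi_i-\varphi_j))}$ and let $$\Omega=\{w:\ r_i\in(R_{in},R_{out}),\ s_i\in(-\Theta,\Theta),\ v_i\in(0,v_{\max})\text{ for all } i,\ d_{i,j}>L_{i,j}\text{ for all } i\ne j\}.$$ For $w\in\Omega$ define $$H(w)=\tfrac12\sum_i\Big(\tfrac{v_i}{r_i}\cos s_i-\omega^*\Big)^2+\tfrac b2\sum_i v_i^2\sin^2 s_i+\sum_iU_i(r_i)+\tfrac12\sum_i\sum_{j\ne i}V_{i,j}(d_{i,j})+A\sum_i\Big(\tfrac1{\cos s_i-\cos\Theta}-\tfrac1{1-\cos\Theta}\Big),$$ $$a(r,s,v)=\Big(b-\tfrac1{r^2}\Big)v^2\cos s+\omega^*\tfrac vr+\tfrac{A}{(\cos s-\cos\Theta)^2},$$ $$\Lambda_i=\Big(\tfrac{v_i}{r_i}\cos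 s_i-\omega^*\Big)\tfrac{v_i\cos s_i}{r_i^2}-U_i'(r_i)-\sum_{j\ne i}\big(p_{i,j}(r_i-r_j)+r_j(1-\cos(\varphi_i-\varphi_j))\big)\tfrac{V_{i,j}'(d_{i,j})}{d_{i,j}},$$ $$\Phi_i=\tfrac{r_i}{\omega^*}\sum_{j\ne i}V_{i,j}'(d_{i,j})\tfrac{r_j\sin(\varphi_i-\varphi_j)}{d_{i,j}},\qquad G_i=\tfrac1{\omega^*}\sum_{j\ne i}\kappa_{i,j}(d_{i,j})\Big(g_1\big(\tfrac{v_j}{r_j}\cos s_j\big)-g_1\big(\tfrac{v_i}{r_i}\cos s_i\big)\Big),$$ $$M_i=\sum_{j\ne i}\kappa_{i,j}(d_{i,j})\big(g_2(\sin s_j)-g_2(\sin s_i)\big),$$ $$k_i=\mu_1+\Phi_i-G_i+f\Big(-\tfrac{v_{\max}\cos s_i}{v_{\max}\cos s_i-r_i\omega^*}(\Phi_i-G_i)\Big),$$ and the Newtonian cruise controller $$F_i=-k_i\Big(v_i-\tfrac{r_i\omega^*}{\cos s_i}\Big)-\tfrac{r_i\omega^*}{\cos s_i}(\Phi_i-G_i),$$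 $$\delta_i=\arctan\Big(\tfrac{\sigma_i}{r_i}\cos s_i-\tfrac{\sigma_i}{v_i\,a(r_i,s_i,v_i)}\big(\mu_2\sin s_i+(bF_i\sin s_i+\Lambda_i)v_i-M_i\big)\Big).$$ The closed-loop system on $\Omega$ is the polar bicycle model with these feedback laws: $$\dot r_i=-v_i\sin s_i,\quad \dot\varphi_i=\tfrac{v_i}{r_i}\cos s_i,\quad \dot s_i=\tfrac{v_i}{\sigma_i}\tan\delta_i-\tfrac{v_i}{r_i}\cos s_i,\quad \dot v_i=F_i .$$ **Theorem 1.** There exists a non-decreasing function $P_1:[0,\infty)\to[0,\infty)$ such that for every $w_0\in\Omega$ the closed-loop system with $w(0)=w_0$ has a solution $w(t)$ defined for all $t\ge0$ with $w(t)\in\Omega$ for all $t\ge 0$; it is unique, in the sense that every solution in $\Omega$ on an interval $[0,T)$, $T>0$, with the same initial value coincides with $w$ on $[0,T)$. (In particular there are no collisions and no boundary violations, the speeds stay in $(0,v_{\max})$, and $|s_i|<\Theta$.) Moreover, for all $i$, as $t\to+\infty$, $$s_i(t)\to0,\qquad \frac{v_i(t)}{r_i(t)}\to\omega^*,\qquad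 \dot s_i(t)\to0,\qquad F_i(t)\to0,$$ and $$|F_i(t)|+|\delta_i(t)|\le P_1(H(w_0))\qquad\text{for all }t\ge0\text{ and all }i .$$ -/

import Mathlib

open Set Filter Topology

noncomputable section

namespace RingRoad

/-- The state `w = (r, φ, s, v)` of `n` vehicles: radii, angular coordinates, relative
orientations and speeds. -/
abbrev State (n : ℕ) : Type :=
  (Fin n → ℝ) × (Fin n → ℝ) × (Fin n → ℝ) × (Fin n → ℝ)

namespace State

variable {n : ℕ}

/-- Radii. -/
abbrev r (w : State n) : Fin n → ℝ := w.1

/-- Angular coordinates. -/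
abbrev φ (w : State n) : Fin n → ℝ := w.2.1

/-- Relative orientations. -/
abbrev s (w : State n) : Fin n → ℝ := w.2.2.1

/-- Speeds. -/
abbrev v (w : State n) : Fin n → ℝ := w.2.2.2

end State

/-- The data of the ring-road, of the vehicles, and of the Newtonian cruise controller.
Functions that are only given on an interval are represented by total functions; only their
values on that interval are constrained (see `Params.Admissible`) or used on the state space. -/
structure Params (n : ℕ) where
  /-- inner radius -/
  Rin : ℝ
  /-- outer radius -/
  Rout : ℝ
  /-- speed limit -/
  vmax : ℝ
  /-- angular speed set-point -/
  ω : ℝ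
  /-- maximal deviation of the heading angle from the tangent of the ring-road -/
  Θ : ℝ
  /-- vehicle lengths -/
  σ : Fin n → ℝ
  /-- weights of the inter-vehicle distance -/
  p : Fin n → Fin n → ℝ
  /-- minimal inter-vehicle distances -/
  L : Fin n → Fin n → ℝ
  /-- interaction range -/
  lam : ℝ
  /-- inter-vehicle potentials, on `(L i j, ∞)` -/
  V : Fin n → Fin n → ℝ → ℝ
  /-- boundary potentials, on `(Rin, Rout)` -/
  U : Fin n → ℝ → ℝ
  /-- viscosity coefficients, on `(L i j, ∞)` -/
  κ : Fin n → Fin n → ℝ → ℝ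
  g₁ : ℝ → ℝ
  g₂ : ℝ → ℝ
  f : ℝ → ℝ
  A : ℝ
  b : ℝ
  μ₁ : ℝ
  μ₂ : ℝ

namespace Params

variable {n : ℕ}

/-- The standing assumptions on the parameters. -/
structure Admissible (P : Params n) : Prop where
  Rin_pos : 0 < P.Rin
  Rin_lt_Rout : P.Rin < P.Rout
  vmax_pos : 0 < P.vmax
  ω_pos : 0 < P.ω
  ω_lt : P.ω < P.vmax / P.Rout
  Θ_pos : 0 < P.Θ
  Θ_lt : P.Θ < Real.pi / 2
  cos_Θ : P.Rout * P.ω / P.vmax < Real.cos P.Θ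
  σ_pos : ∀ i, 0 < P.σ i
  p_pos : ∀ i j, 0 < P.p i j
  p_symm : ∀ i j, P.p i j = P.p j i
  L_pos : ∀ i j, i ≠ j → 0 < P.L i j
  L_symm : ∀ i j, i ≠ j → P.L i j = P.L j i
  lam_pos : 0 < P.lam
  L_lt_lam : ∀ i j, i ≠ j → P.L i j < P.lam
  V_contDiff : ∀ i j, i ≠ j → ContDiffOn ℝ 2 (P.V i j) (Ioi (P.L i j))
  V_nonneg : ∀ i j, i ≠ j → ∀ d ∈ Ioi (P.L i j), 0 ≤ P.V i j d
  V_tendsto : ∀ i j, i ≠ j → Tendsto (P.V i j) (𝓝[>] (P.L i j)) atTop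
  V_eq_zero : ∀ i j, i ≠ j → ∀ d, P.lam ≤ d → P.V i j d = 0
  V_symm : ∀ i j, i ≠ j → ∀ d ∈ Ioi (P.L i j), P.V i j d = P.V j i d
  U_contDiff : ∀ i, ContDiffOn ℝ 2 (P.U i) (Ioo P.Rin P.Rout)
  U_nonneg : ∀ i, ∀ r ∈ Ioo P.Rin P.Rout, 0 ≤ P.U i r
  U_tendsto_in : ∀ i, Tendsto (P.U i) (𝓝[>] P.Rin) atTop
  U_tendsto_out : ∀ i, Tendsto (P.U i) (𝓝[<] P.Rout) atTop
  κ_contDiff : ∀ i j, i ≠ j → ContDiffOn ℝ 1 (P.κ i j) (Ioi (P.L i j))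
  κ_nonneg : ∀ i j, i ≠ j → ∀ d ∈ Ioi (P.L i j), 0 ≤ P.κ i j d
  κ_symm : ∀ i j, i ≠ j → ∀ d ∈ Ioi (P.L i j), P.κ i j d = P.κ j i d
  κ_eq_zero : ∀ i j, i ≠ j → ∀ d, P.lam ≤ d → P.κ i j d = 0
  g₁_contDiff : ContDiff ℝ 1 P.g₁
  g₁_mono : Monotone P.g₁
  g₂_contDiff : ContDiff ℝ 1 P.g₂
  g₂_mono : Monotone P.g₂
  f_contDiff : ContDiff ℝ 1 P.f
  le_f : ∀ x, max 0 x ≤ P.f x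
  A_pos : 0 < P.A
  lt_b : 1 / P.Rin ^ 2 < P.b
  μ₁_pos : 0 < P.μ₁
  μ₂_pos : 0 < P.μ₂

variable (P : Params n)

/-- The (weighted) distance `d_{i,j}` between vehicles `i` and `j`. -/
def dist (w : State n) (i j : Fin n) : ℝ :=
  √(P.p i j * (w.r i - w.r j) ^ 2
    + 2 * w.r i * w.r j * (1 - Real.cos (w.φ i - w.φ j)))

/-- The open state space `Ω`. -/
def Ω : Set (State n) :=
  {w | (∀ i, w.r i ∈ Ioo P.Rin P.Rout) ∧ (∀ i, w.s i ∈ Ioo (-P.Θ) P.Θ) ∧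
    (∀ i, w.v i ∈ Ioo 0 P.vmax) ∧ ∀ i j, j ≠ i → P.L i j < P.dist w i j}

/-- The control Lyapunov function `H`. -/
def H (w : State n) : ℝ :=
  (1 / 2) * ∑ i, (w.v i / w.r i * Real.cos (w.s i) - P.ω) ^ 2
    + P.b / 2 * ∑ i, w.v i ^ 2 * Real.sin (w.s i) ^ 2
    + ∑ i, P.U i (w.r i)
    + (1 / 2) * ∑ i, ∑ j ∈ Finset.univ.erase i, P.V i j (P.dist w i j)
    + P.A * ∑ i, (1 / (Real.cos (w.s i) - Real.cos P.Θ) - 1 / (1 - Real.cos P.Θ))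

/-- The function `a(r, s, v)`. -/
def a (r s v : ℝ) : ℝ :=
  (P.b - 1 / r ^ 2) * v ^ 2 * Real.cos s + P.ω * (v / r)
    + P.A / (Real.cos s - Real.cos P.Θ) ^ 2

/-- The function `Λ_i(w)`. -/
def Lam (w : State n) (i : Fin n) : ℝ :=
  (w.v i / w.r i * Real.cos (w.s i) - P.ω) * (w.v i * Real.cos (w.s i) / w.r i ^ 2)
    - deriv (P.U i) (w.r i)
    - ∑ j ∈ Finset.univ.erase i,
        (P.p i j * (w.r i - w.r j) + w.r j * (1 - Real.cos (w.φ i - w.φ j)))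
          * (deriv (P.V i j) (P.dist w i j) / P.dist w i j)

/-- The function `Φ_i(w)`. -/
def Phi (w : State n) (i : Fin n) : ℝ :=
  w.r i / P.ω * ∑ j ∈ Finset.univ.erase i,
    deriv (P.V i j) (P.dist w i j) * (w.r j * Real.sin (w.φ i - w.φ j) / P.dist w i j)

/-- The viscous term `G_i(w)`. -/
def G (w : State n) (i : Fin n) : ℝ :=
  1 / P.ω * ∑ j ∈ Finset.univ.erase i, P.κ i j (P.dist w i j)
    * (P.g₁ (w.v j / w.r j * Real.cos (w.s j)) - P.g₁ (w.v i / w.r i * Real.cos (w.s i)))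

/-- The viscous term `M_i(w)`. -/
def M (w : State n) (i : Fin n) : ℝ :=
  ∑ j ∈ Finset.univ.erase i, P.κ i j (P.dist w i j)
    * (P.g₂ (Real.sin (w.s j)) - P.g₂ (Real.sin (w.s i)))

/-- The state-dependent gain `k_i(w)`. -/
def k (w : State n) (i : Fin n) : ℝ :=
  P.μ₁ + P.Phi w i - P.G w i
    + P.f (-(P.vmax * Real.cos (w.s i) / (P.vmax * Real.cos (w.s i) - w.r i * P.ω))
        * (P.Phi w i - P.G w i))

/-- The acceleration `F_i(w)` commanded by the Newtonian cruise controller. -/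
def F (w : State n) (i : Fin n) : ℝ :=
  -P.k w i * (w.v i - w.r i * P.ω / Real.cos (w.s i))
    - w.r i * P.ω / Real.cos (w.s i) * (P.Phi w i - P.G w i)

/-- The steering angle `δ_i(w)` commanded by the Newtonian cruise controller. -/
def δ (w : State n) (i : Fin n) : ℝ :=
  Real.arctan (P.σ i / w.r i * Real.cos (w.s i)
    - P.σ i / (w.v i * P.a (w.r i) (w.s i) (w.v i))
      * (P.μ₂ * Real.sin (w.s i)
          + (P.b * P.F w i * Real.sin (w.s i) + P.Lam w i) * w.v i - P.M w i))

/-- The right-hand side of the polar bicycle model at the state `w`, for given accelerations `F`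
and steering angles `δ`. -/
def bicycle (w : State n) (F δ : Fin n → ℝ) : State n :=
  (fun i => -w.v i * Real.sin (w.s i),
   fun i => w.v i / w.r i * Real.cos (w.s i),
   fun i => w.v i / P.σ i * Real.tan (δ i) - w.v i / w.r i * Real.cos (w.s i),
   fun i => F i)

/-- `w` is a solution, on the time interval `I`, of the polar bicycle model in closed loop with the
Newtonian cruise controller. As the feedback is given on `Ω` only, solutions take values there. -/
def IsSolutionOn (I : Set ℝ) (w : ℝ → State n) : Prop :=
  ∀ t ∈ I, w t ∈ P.Ω ∧
    HasDerivWithinAt w (P.bicycle (w t) (P.F (w t)) (P.δ (w t))) I t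

end Params

end RingRoad

end

/-! `H` is a Lyapunov function for which the controller is tailored. In the derivative of `H`, the
function `a` collects all coefficients of `ṡ sin s`, and `Lam` collects the remaining forces
multiplied by `v sin s`, apart from the term with `b F`; the feedback replaces them by damping and
viscosity (`dissipation_identity`). The interaction forces add up to zero, so angular speeds may be
measured relative to `ω`; the viscous terms are nonpositive after symmetrization. Since `μ₁ ≤ k`,
the derivative of `H` is at most `-∑ (μ₁ (angular speed - ω)² + μ₂ sin² s)` (`Hdot_le`).

Invariance: `H` does not increase and its potentials blow up at the boundary, which confines radii,
headings and distances (`exists_sublevel_subset_box`). `H` does not keep the speeds off their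
limits; the gain `k` does, by making `F` positive near speed `0` and negative near `vmax` (`F_ge`,
`F_le`, `exists_speed_bounds`). The angles grow at most linearly, so on each bounded time interval
solutions stay in a compact subset of `Ω`, and they extend to all times.

Convergence: the relevant observables are invariant under full turns of each vehicle, so compactness
modulo turns makes them uniformly continuous along trajectories although the angles are unbounded.
Barbalat's lemma, applied to `H`, to `s i` and to the angular speeds, gives the limits. -/

/-- `w` is a solution of `ẋ = X x` on `I` with values in `Ω`. -/
def SolvesIn {E : Type*} [NormedAddCommGroup E] [NormedSpace ℝ E] (X : E → E) (Ω : Set E)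
    (I : Set ℝ) (w : ℝ → E) : Prop :=
  ∀ t ∈ I, w t ∈ Ω ∧ HasDerivWithinAt w (X (w t)) I t

/-! ### Flows of `C¹` vector fields on open sets: uniqueness and continuation. -/

namespace SolvesIn

section

variable {E : Type*} [NormedAddCommGroup E] [NormedSpace ℝ E] {X : E → E} {Ω : Set E}
  {I J : Set ℝ} {w y : ℝ → E}

theorem mono (h : SolvesIn X Ω I w) (hJ : J ⊆ I) : SolvesIn X Ω J w :=
  fun t ht => ⟨(h t (hJ ht)).1, (h t (hJ ht)).2.mono hJ⟩

theorem continuousOn (h : SolvesIn X Ω I w) : ContinuousOn w I :=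
  fun t ht => (h t ht).2.continuousWithinAt

/-- Uniqueness by Grönwall and the barrier argument for the speeds are both stated with right
derivatives. -/
theorem hasDerivWithinAt_Ici {T : ℝ} (h : SolvesIn X Ω (Icc 0 T) w) {t : ℝ} (ht : t ∈ Ico 0 T) :
    HasDerivWithinAt w (X (w t)) (Ici t) t :=
  (h t ⟨ht.1, ht.2.le⟩).2.mono_of_mem_nhdsWithin
    (mem_of_superset (Icc_mem_nhdsGE ht.2) (Icc_subset_Icc_left ht.1))

end

end SolvesIn

section

variable {E : Type*} [NormedAddCommGroup E] [NormedSpace ℝ E] [FiniteDimensional ℝ E]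
  {X : E → E} {Ω K : Set E}

/-- A `C¹` vector field on an open set agrees near a compact subset with a vector field which is
bounded and Lipschitz on the whole space. -/
theorem exists_lipschitz_eqOn_of_isCompact (hΩ : IsOpen Ω) (hX : ContDiffOn ℝ 1 X Ω)
    (hK : IsCompact K) (hKΩ : K ⊆ Ω) :
    ∃ (Y : E → E) (W : Set E) (C B : NNReal), IsOpen W ∧ K ⊆ W ∧ W ⊆ Ω ∧ EqOn Y X W ∧
      LipschitzWith C Y ∧ ∀ x, ‖Y x‖ ≤ B := by
  -- Two nested compact neighbourhoods leave room for a cutoff `χ` equal to `1` on `S` and supported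
  -- in `S'`; then `χ • X` is globally `C¹` with compact support.
  obtain ⟨S, hS, hKS, hSΩ⟩ := exists_compact_between hK hΩ hKΩ
  obtain ⟨S', hS', hSS', hS'Ω⟩ := exists_compact_between hS hΩ hSΩ
  obtain ⟨χ, χ_smooth, -, χ_supp, hχ⟩ :=
    exists_contMDiff_support_eq_eq_one_iff (n := 1) (modelWithCornersSelf ℝ E) isOpen_interior
      hS.isClosed hSS'
  have hts : tsupport χ ⊆ S' := by
    rw [tsupport, χ_supp]
    exact closure_minimal interior_subset hS'.isClosed
  have hcs : HasCompactSupport (fun x => χ x • X x) :=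
    HasCompactSupport.smul_right (HasCompactSupport.of_support_subset_isCompact hS'
      (subset_closure.trans hts))
  have hY : ContDiff ℝ 1 (fun x => χ x • X x) := by
    refine contDiff_iff_contDiffAt.2 fun x => ?_
    by_cases hx : x ∈ tsupport χ
    swap
    · refine contDiffAt_const (c := (0 : E)) |>.congr_of_eventuallyEq ?_
      filter_upwards [notMem_tsupport_iff_eventuallyEq.1 hx] with z hz
      simp [hz]
    have hxΩ : x ∈ Ω := hS'Ω (hts hx)
    exact (χ_smooth.contDiff.contDiffAt).smul (hX.contDiffAt (hΩ.mem_nhds hxΩ))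
  obtain ⟨C, hC⟩ := hY.lipschitzWith_of_hasCompactSupport (𝕂 := ℝ) hcs one_ne_zero
  obtain ⟨B, hB⟩ := hcs.exists_bound_of_continuous hY.continuous
  refine ⟨_, interior S, C, ⟨max B 0, le_max_right _ _⟩, isOpen_interior, hKS,
    interior_subset.trans hSΩ, fun x hx => ?_, hC, fun x => (hB x).trans (le_max_left _ _)⟩
  simp [(hχ x).1 (interior_subset hx)]

/-- Uniqueness for a `C¹` vector field on an open set. -/
theorem SolvesIn.eqOn_Icc (hΩ : IsOpen Ω) (hX : ContDiffOn ℝ 1 X Ω) {T : ℝ} {w y : ℝ → E}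
    (hw : SolvesIn X Ω (Icc 0 T) w) (hy : SolvesIn X Ω (Icc 0 T) y) (h0 : w 0 = y 0) :
    EqOn w y (Icc 0 T) := by
  -- `X` need not be Lipschitz on `Ω`, but on the union of the two compact trajectories it agrees
  -- with a globally Lipschitz field.
  have hK : IsCompact (w '' Icc 0 T ∪ y '' Icc 0 T) :=
    (isCompact_Icc.image_of_continuousOn hw.continuousOn).union
      (isCompact_Icc.image_of_continuousOn hy.continuousOn)
  obtain ⟨Y, W, C, -, -, hKW, -, hYX, hC, -⟩ := exists_lipschitz_eqOn_of_isCompact hΩ hX hK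
    (by rintro _ (⟨t, ht, rfl⟩ | ⟨t, ht, rfl⟩); exacts [(hw t ht).1, (hy t ht).1])
  refine ODE_solution_unique_of_mem_Icc_right (v := fun _ => X)
    (s := fun _ => w '' Icc 0 T ∪ y '' Icc 0 T) (K := C) (fun t _ => ?_)
    hw.continuousOn (fun t ht => hw.hasDerivWithinAt_Ici ht)
    (fun t ht => Or.inl ⟨t, Ico_subset_Icc_self ht, rfl⟩)
    hy.continuousOn (fun t ht => hy.hasDerivWithinAt_Ici ht)
    (fun t ht => Or.inr ⟨t, Ico_subset_Icc_self ht, rfl⟩) h0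
  intro a ha b hb
  rw [← hYX (hKW ha), ← hYX (hKW hb)]
  exact hC a b

/-- If all solutions from `x₀` up to time `T` stay in a compact subset of `Ω`, then
there is a solution on `[0, T]`. -/
theorem SolvesIn.exists_Icc (hΩ : IsOpen Ω) (hX : ContDiffOn ℝ 1 X Ω) {x₀ : E} {T : ℝ}
    (hT : 0 ≤ T) (hK : IsCompact K) (hKΩ : K ⊆ Ω) (hx₀ : x₀ ∈ K)
    (apriori : ∀ t ∈ Icc 0 T, ∀ y : ℝ → E, y 0 = x₀ → SolvesIn X Ω (Icc 0 t) y → y t ∈ K) :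
    ∃ w : ℝ → E, w 0 = x₀ ∧ SolvesIn X Ω (Icc 0 T) w := by
  obtain ⟨Y, W, C, B, hW, hKW, hWΩ, hYX, hC, hB⟩ := exists_lipschitz_eqOn_of_isCompact hΩ hX hK hKΩ
  -- The field `Y` is bounded by `B` everywhere, so the ball of radius `B * T` cannot be left before
  -- time `T` and Picard–Lindelöf covers the whole interval.
  have hPL : IsPicardLindelof (fun _ => Y) (⟨0, left_mem_Icc.2 hT⟩ : Icc 0 T) x₀
      (B * ⟨T, hT⟩) 0 B C :=
    IsPicardLindelof.of_time_independent (fun x _ => hB x) hC.lipschitzOnWith (by simp [hT]; rfl)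
  obtain ⟨w, hw0, hw⟩ := hPL.exists_eq_forall_mem_Icc_hasDerivWithinAt₀
  have hw0 : w 0 = x₀ := hw0
  have hcont : ContinuousOn w (Icc 0 T) := fun t ht => (hw t ht).continuousWithinAt
  have hsol : ∀ t ∈ Icc 0 T, (∀ s ∈ Icc 0 t, w s ∈ W) → SolvesIn X Ω (Icc 0 t) w := by
    intro t ht h s hs
    refine ⟨hWΩ (h s hs), ?_⟩
    rw [← hYX (h s hs)]
    exact (hw s ⟨hs.1, hs.2.trans ht.2⟩).mono (Icc_subset_Icc_right ht.2)
  -- Continuous induction: while in `W` the curve solves the original equation, and the a priori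
  -- hypothesis then puts it back into `K`, whence it can go on a little inside `W`.
  have key : Icc 0 T ⊆ {t | ∀ s ∈ Icc 0 t, w s ∈ K} := by
    refine IsClosed.Icc_subset_of_forall_exists_gt ?_ ?_ ?_
    · refine IsSeqClosed.isClosed fun τ t hτ hτt => ?_
      have htT : t ∈ Icc 0 T := isClosed_Icc.mem_of_tendsto hτt (.of_forall fun k => (hτ k).2)
      refine ⟨fun s hs => ?_, htT⟩
      rcases hs.2.lt_or_eq with hst | rfl
      · obtain ⟨k, hk⟩ := (hτt.eventually_const_lt hst).exists
        exact (hτ k).1 s ⟨hs.1, hk.le⟩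
      · refine hK.isClosed.mem_of_tendsto (((hcont s htT).tendsto).comp
          (tendsto_nhdsWithin_iff.2 ⟨hτt, .of_forall fun k => (hτ k).2⟩)) (.of_forall fun k => ?_)
        exact (hτ k).1 _ ⟨(hτ k).2.1, le_rfl⟩
    · intro s hs
      obtain rfl : s = 0 := le_antisymm hs.2 hs.1
      rwa [hw0]
    · rintro t ⟨htK, ht⟩ u hu
      have h1 : w ⁻¹' W ∈ 𝓝[≥] t :=
        nhdsWithin_le_of_mem (mem_of_superset (Icc_mem_nhdsGE ht.2) (Icc_subset_Icc_left ht.1))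
          (hcont t ⟨ht.1, ht.2.le⟩ (hW.mem_nhds (hKW (htK t ⟨ht.1, le_rfl⟩))))
      obtain ⟨q, hq, hqW⟩ := (mem_nhdsGE_iff_exists_Icc_subset).1 h1
      have h2 : ∀ᶠ s in 𝓝[>] t, ∀ z ∈ Icc t s, w z ∈ W :=
        mem_of_superset (Ioc_mem_nhdsGT hq) fun s hs z hz => hqW ⟨hz.1, hz.2.trans hs.2⟩
      have h3 : ∀ᶠ s in 𝓝[>] t, s ∈ Ioc t (min u T) :=
        Ioc_mem_nhdsGT (lt_min hu ht.2)
      obtain ⟨s, hs2, hs3⟩ := (h2.and h3).exists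
      refine ⟨s, fun z hz => ?_, hs3.1, hs3.2.trans (min_le_left _ _)⟩
      have hsT : s ∈ Icc 0 T := ⟨hz.1.trans hz.2, hs3.2.trans (min_le_right _ _)⟩
      have := hsol s hsT fun z hz => by
        rcases le_total z t with hzt | hzt
        · exact hKW (htK z ⟨hz.1, hzt⟩)
        · exact hs2 z ⟨hzt, hz.2⟩
      exact apriori z ⟨hz.1, hz.2.trans hsT.2⟩ w hw0 (this.mono (Icc_subset_Icc_right hz.2))
  exact ⟨w, hw0, hsol T ⟨hT, le_rfl⟩ fun s hs => hKW (key ⟨hT, le_rfl⟩ s hs)⟩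

/-- If, for every `T`, all solutions from `x₀` up to time `T` stay in a compact subset of
`Ω`, then there is a solution on `[0, ∞)`. -/
theorem SolvesIn.exists_Ici (hΩ : IsOpen Ω) (hX : ContDiffOn ℝ 1 X Ω) {x₀ : E}
    (hx₀ : x₀ ∈ Ω) (apriori : ∀ T, ∃ K : Set E, IsCompact K ∧ K ⊆ Ω ∧
      ∀ t ∈ Icc 0 T, ∀ y : ℝ → E, y 0 = x₀ → SolvesIn X Ω (Icc 0 t) y → y t ∈ K) :
    ∃ w : ℝ → E, w 0 = x₀ ∧ SolvesIn X Ω (Ici 0) w := by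
  have hex : ∀ N : ℕ, ∃ w : ℝ → E, w 0 = x₀ ∧ SolvesIn X Ω (Icc 0 N) w := by
    intro N
    obtain ⟨K, hK, hKΩ, h⟩ := apriori N
    refine SolvesIn.exists_Icc hΩ hX N.cast_nonneg (hK.insert x₀)
      (insert_subset hx₀ hKΩ) (mem_insert _ _) fun t ht y hy0 hy => Or.inr (h t ht y hy0 hy)
  choose u hu0 hu using hex
  have huu : ∀ {M N : ℕ} {t : ℝ}, 0 ≤ t → t ≤ M → t ≤ N → u M t = u N t := by
    intro M N t h0 hM hN
    exact ((hu M).mono (Icc_subset_Icc_right hM)).eqOn_Icc hΩ hX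
      ((hu N).mono (Icc_subset_Icc_right hN)) ((hu0 M).trans (hu0 N).symm) ⟨h0, le_rfl⟩
  -- The glued curve agrees with `u (⌈t⌉₊ + 1)` up to a time beyond `t`; the extra `1` is needed at
  -- integer `t`, where `u ⌈t⌉₊` is a solution only up to `t` itself.
  refine ⟨fun t => u ⌈t⌉₊ t, hu0 _, fun t ht => ?_⟩
  have ht0 : (0 : ℝ) ≤ t := ht
  have hlt : t < (⌈t⌉₊ + 1 : ℕ) := by push_cast; linarith [Nat.le_ceil t]
  have hEq : ∀ s ∈ Icc 0 ((⌈t⌉₊ + 1 : ℕ) : ℝ), u ⌈s⌉₊ s = u (⌈t⌉₊ + 1) s :=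
    fun s hs => huu hs.1 (Nat.le_ceil s) hs.2
  obtain ⟨h1, h2⟩ := hu (⌈t⌉₊ + 1) t ⟨ht0, hlt.le⟩
  simp only [hEq t ⟨ht0, hlt.le⟩]
  refine ⟨h1, ?_⟩
  have h3 : HasDerivWithinAt (fun t => u ⌈t⌉₊ t) (X (u (⌈t⌉₊ + 1) t))
      (Icc 0 ((⌈t⌉₊ + 1 : ℕ) : ℝ)) t := h2.congr hEq (hEq t ⟨ht0, hlt.le⟩)
  refine h3.mono_of_mem_nhdsWithin ?_
  rw [← Ici_inter_Iic]
  exact inter_mem_nhdsWithin _ (Iic_mem_nhds hlt)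

end

/-! ### Tools for convergence. -/

/-- **Barbalat's lemma.** If `x` converges at infinity and its derivative is uniformly continuous,
then the derivative tends to zero. -/
theorem tendsto_zero_of_hasDerivAt_of_uniformContinuousOn {x x' : ℝ → ℝ} {l : ℝ}
    (hx : ∀ t, 0 < t → HasDerivAt x (x' t) t) (hl : Tendsto x atTop (𝓝 l))
    (hu : UniformContinuousOn x' (Ici 0)) : Tendsto x' atTop (𝓝 0) := by
  rw [Metric.tendsto_atTop]
  intro ε hε
  obtain ⟨d, hd, hud⟩ := Metric.uniformContinuousOn_iff.1 hu (ε / 2) (half_pos hε)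
  -- With this tolerance the mean slope over a window of length `d / 2` is below `ε / 2` in absolute
  -- value, and `x'` varies by less than `ε / 2` in the window.
  obtain ⟨N, hN⟩ := Metric.tendsto_atTop.1 hl (ε / 2 * (d / 2) / 2) (by positivity)
  refine ⟨max N 1, fun t ht => ?_⟩
  have htN : N ≤ t := (le_max_left _ _).trans ht
  have ht1 : 1 ≤ t := (le_max_right _ _).trans ht
  obtain ⟨c, hc, hceq⟩ := exists_hasDerivAt_eq_slope x x' (show t < t + d / 2 by linarith)
    (fun s hs => (hx s (by linarith [hs.1])).continuousAt.continuousWithinAt)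
    (fun s hs => hx s (by linarith [hs.1]))
  have h1 := hN t htN
  have h2 := hN (t + d / 2) (by linarith)
  have h3 := hud t (by simp; linarith) c (by simp; linarith [hc.1])
    (by rw [Real.dist_eq, abs_lt]; constructor <;> linarith [hc.1, hc.2])
  rw [Real.dist_eq, abs_lt] at h1 h2 h3 ⊢
  have h4 : x' c * (d / 2) = x (t + d / 2) - x t := by
    rw [hceq, add_sub_cancel_left, div_mul_cancel₀ _ (by positivity)]
  have h5 : x' c < ε / 2 := by
    by_contra hcon
    nlinarith
  have h6 : -(ε / 2) < x' c := by
    by_contra hcon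
    nlinarith
  constructor <;> linarith

theorem tendsto_zero_of_sq {α : Type*} {l : Filter α} {x : α → ℝ}
    (h : Tendsto (fun t => x t ^ 2) l (𝓝 0)) : Tendsto x l (𝓝 0) := by
  have h2 := (Real.continuous_sqrt.tendsto 0).comp h
  simp only [Real.sqrt_zero, Function.comp_def, Real.sqrt_sq_eq_abs] at h2
  exact (tendsto_zero_iff_abs_tendsto_zero x).2 h2

namespace RingRoad

namespace Params

variable {n : ℕ} {P : Params n}

/-! ### The closed-loop field: openness of the domain and signs of the denominators. -/

/-- The states whose radii, orientations and mutual distances are admissible, without constraint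
on the speeds. -/
def dom (P : Params n) : Set (State n) :=
  {w | (∀ i, w.r i ∈ Ioo P.Rin P.Rout) ∧ (∀ i, w.s i ∈ Ioo (-P.Θ) P.Θ) ∧
    ∀ i j, j ≠ i → P.L i j < P.dist w i j}

/-- The angular speed of the vehicle `i`. -/
noncomputable def angSpeed (w : State n) (i : Fin n) : ℝ := w.v i / w.r i * Real.cos (w.s i)

/-- The closed-loop value of `ṡ i`. -/
noncomputable def sdot (P : Params n) (w : State n) (i : Fin n) : ℝ :=
  -(P.μ₂ * Real.sin (w.s i) + (P.b * P.F w i * Real.sin (w.s i) + P.Lam w i) * w.v i - P.M w i)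
    / P.a (w.r i) (w.s i) (w.v i)

/-- The closed-loop vector field. -/
noncomputable def field (P : Params n) (w : State n) : State n :=
  (fun i => -w.v i * Real.sin (w.s i), fun i => angSpeed w i, fun i => P.sdot w i,
    fun i => P.F w i)

/-- The larger set `dom` admits the limit speeds `0` and `vmax`. Hence `F` and `k` can be bounded by
compactness before any bound on the speeds is known. -/
theorem Ω_subset_dom : P.Ω ⊆ P.dom := fun _ hw => ⟨hw.1, hw.2.1, hw.2.2.2⟩

theorem continuous_dist (i j : Fin n) : Continuous fun w : State n => P.dist w i j := by
  unfold dist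
  fun_prop

theorem isOpen_dom : IsOpen P.dom := by
  simp only [dom, ofPred_and, ofPred_forall]
  refine .inter (isOpen_iInter_of_finite fun i => ?_) (.inter (isOpen_iInter_of_finite fun i => ?_)
    (isOpen_iInter_of_finite fun i => isOpen_iInter_of_finite fun j =>
      isOpen_iInter_of_finite fun _ => isOpen_lt continuous_const (continuous_dist i j)))
  · exact isOpen_Ioo.preimage (by fun_prop : Continuous fun w : State n => w.1 i)
  · exact isOpen_Ioo.preimage (by fun_prop : Continuous fun w : State n => w.2.2.1 i)

theorem isOpen_Ω : IsOpen P.Ω := by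
  have : P.Ω = P.dom ∩ ⋂ i, {w | w.v i ∈ Ioo 0 P.vmax} := by
    ext w
    simp only [Ω, dom, mem_inter_iff, mem_iInter, mem_ofPred_eq]
    tauto
  rw [this]
  exact isOpen_dom.inter (isOpen_iInter_of_finite fun i =>
    isOpen_Ioo.preimage (by fun_prop : Continuous fun w : State n => w.2.2.2 i))

namespace Admissible

section Positivity

theorem cos_Θ_pos (hP : P.Admissible) : 0 < Real.cos P.Θ :=
  Real.cos_pos_of_mem_Ioo ⟨by linarith [hP.Θ_pos, Real.pi_pos], hP.Θ_lt⟩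

theorem cos_Θ_lt_cos (hP : P.Admissible) {x : ℝ} (hx : x ∈ Ioo (-P.Θ) P.Θ) :
    Real.cos P.Θ < Real.cos x := by
  rw [← Real.cos_abs x]
  exact Real.cos_lt_cos_of_nonneg_of_le_pi (abs_nonneg x)
    (by linarith [hP.Θ_lt, Real.pi_pos]) (abs_lt.2 hx)

theorem Rout_mul_ω_lt (hP : P.Admissible) : P.Rout * P.ω < P.vmax * Real.cos P.Θ := by
  have := (div_lt_iff₀ hP.vmax_pos).1 hP.cos_Θ
  linarith

variable {w : State n}

theorem r_pos (hP : P.Admissible) (hw : w ∈ P.dom) (i : Fin n) :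
    0 < w.1 i := hP.Rin_pos.trans (hw.1 i).1

theorem cos_pos (hP : P.Admissible) (hw : w ∈ P.dom) (i : Fin n) : 0 < Real.cos (w.2.2.1 i) :=
  hP.cos_Θ_pos.trans (hP.cos_Θ_lt_cos (hw.2.1 i))

/-- The speed `r ω / cos s` targeted by the controller lies below `vmax`; the difference is the
denominator in `k`. -/
theorem r_mul_ω_lt (hP : P.Admissible) (hw : w ∈ P.dom) (i : Fin n) :
    w.1 i * P.ω < P.vmax * Real.cos (w.2.2.1 i) := by
  have h1 := hP.Rout_mul_ω_lt
  have h2 := mul_lt_mul_of_pos_left (hP.cos_Θ_lt_cos (hw.2.1 i)) hP.vmax_pos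
  have h3 := mul_lt_mul_of_pos_right (hw.1 i).2 hP.ω_pos
  linarith

theorem dist_pos (hP : P.Admissible) (hw : w ∈ P.dom) {i j : Fin n} (hij : j ≠ i) :
    0 < P.dist w i j :=
  (hP.L_pos i j hij.symm).trans (hw.2.2 i j hij)

/-- Here `1 / Rin² < b` is needed: it makes the coefficient of `v² cos s` nonnegative, and the
barrier term is strictly positive. -/
theorem a_pos (hP : P.Admissible) (hw : w ∈ P.dom) (i : Fin n) (hv : 0 ≤ w.2.2.2 i) :
    0 < P.a (w.1 i) (w.2.2.1 i) (w.2.2.2 i) := by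
  have hr := hP.r_pos hw i
  have hc := hP.cos_pos hw i
  have hΘ := sub_pos.2 (hP.cos_Θ_lt_cos (hw.2.1 i))
  have hb : 0 ≤ P.b - 1 / w.1 i ^ 2 := by
    have : 1 / w.1 i ^ 2 ≤ 1 / P.Rin ^ 2 :=
      one_div_le_one_div_of_le (pow_pos hP.Rin_pos 2)
        (pow_le_pow_left₀ hP.Rin_pos.le (hw.1 i).1.le 2)
    linarith [hP.lt_b]
  have := hP.A_pos
  have := hP.ω_pos
  unfold a
  positivity

/-- The tangent undoes the arctangent; the term `σ / r cos s` in the steering law cancels the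
rotation of the tangent direction, and `v / σ` cancels the prefactor of the rest. -/
theorem bicycle_eq_field (hP : P.Admissible) (hw : w ∈ P.Ω) :
    P.bicycle w (P.F w) (P.δ w) = P.field w := by
  refine Prod.ext rfl (Prod.ext rfl (Prod.ext (funext fun i => ?_) rfl))
  have hv : 0 < w.2.2.2 i := (hw.2.2.1 i).1
  have ha := hP.a_pos (Ω_subset_dom hw) i hv.le
  have hr := hP.r_pos (Ω_subset_dom hw) i
  have hσ := hP.σ_pos i
  simp only [bicycle, field, δ, sdot, Real.tan_arctan]
  field_simp
  ring

theorem isSolutionOn_iff (hP : P.Admissible) {I : Set ℝ} {w : ℝ → State n} :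
    P.IsSolutionOn I w ↔ SolvesIn P.field P.Ω I w := by
  refine forall₂_congr fun t _ => and_congr_right fun h => ?_
  rw [hP.bicycle_eq_field h]

end Positivity

/-! ### The feedback is continuously differentiable. -/

section Regularity

theorem contDiffOn_dist (hP : P.Admissible) {i j : Fin n} (hij : j ≠ i) :
    ContDiffOn ℝ 1 (fun w => P.dist w i j) P.dom := by
  unfold dist
  refine ContDiffOn.sqrt (by fun_prop) fun w hw => ?_
  exact (Real.sqrt_pos.1 (hP.dist_pos hw hij)).ne'

theorem contDiffOn_comp_dist (hP : P.Admissible) {i j : Fin n} (hij : j ≠ i) {h : ℝ → ℝ}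
    (hh : ContDiffOn ℝ 1 h (Ioi (P.L i j))) :
    ContDiffOn ℝ 1 (fun w => h (P.dist w i j)) P.dom :=
  hh.comp (hP.contDiffOn_dist hij) fun _ hw => hw.2.2 i j hij

theorem contDiffOn_deriv_V (hP : P.Admissible) {i j : Fin n} (hij : j ≠ i) :
    ContDiffOn ℝ 1 (fun w => deriv (P.V i j) (P.dist w i j)) P.dom :=
  hP.contDiffOn_comp_dist hij
    ((hP.V_contDiff i j hij.symm).deriv_of_isOpen isOpen_Ioi (by norm_num))

theorem contDiffOn_angSpeed (hP : P.Admissible) (i : Fin n) :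
    ContDiffOn ℝ 1 (fun w => angSpeed w i) P.dom := by
  unfold angSpeed
  exact (ContDiffOn.div (by fun_prop) (by fun_prop) fun w hw => (hP.r_pos hw i).ne').mul
    (by fun_prop)

theorem contDiffOn_Phi (hP : P.Admissible) (i : Fin n) :
    ContDiffOn ℝ 1 (fun w => P.Phi w i) P.dom := by
  unfold Phi
  refine ContDiffOn.mul (by fun_prop) (ContDiffOn.sum fun j hj => ?_)
  have hij := Finset.ne_of_mem_erase hj
  exact (hP.contDiffOn_deriv_V hij).mul (ContDiffOn.div (by fun_prop) (hP.contDiffOn_dist hij)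
    fun w hw => (hP.dist_pos hw hij).ne')

theorem contDiffOn_G (hP : P.Admissible) (i : Fin n) : ContDiffOn ℝ 1 (fun w => P.G w i) P.dom := by
  unfold G
  refine ContDiffOn.mul (by fun_prop) (ContDiffOn.sum fun j hj => ?_)
  have hij := Finset.ne_of_mem_erase hj
  exact (hP.contDiffOn_comp_dist hij (hP.κ_contDiff i j hij.symm)).mul
    ((hP.g₁_contDiff.comp_contDiffOn (hP.contDiffOn_angSpeed j)).sub
      (hP.g₁_contDiff.comp_contDiffOn (hP.contDiffOn_angSpeed i)))

theorem contDiffOn_M (hP : P.Admissible) (i : Fin n) : ContDiffOn ℝ 1 (fun w => P.M w i) P.dom := by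
  unfold M
  refine ContDiffOn.sum fun j hj => ?_
  have hij := Finset.ne_of_mem_erase hj
  have hg := hP.g₂_contDiff
  exact (hP.contDiffOn_comp_dist hij (hP.κ_contDiff i j hij.symm)).mul (by fun_prop)

theorem contDiffOn_Lam (hP : P.Admissible) (i : Fin n) :
    ContDiffOn ℝ 1 (fun w => P.Lam w i) P.dom := by
  unfold Lam
  refine ContDiffOn.sub (ContDiffOn.sub (ContDiffOn.mul ?_ ?_) ?_) (ContDiffOn.sum fun j hj => ?_)
  · exact (hP.contDiffOn_angSpeed i).sub contDiffOn_const
  · exact ContDiffOn.div (by fun_prop) (by fun_prop) fun w hw => (pow_pos (hP.r_pos hw i) 2).ne'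
  · exact ((hP.U_contDiff i).deriv_of_isOpen (m := 1) isOpen_Ioo (by norm_num)).comp
      (by fun_prop : ContDiffOn ℝ 1 (fun w : State n => w.1 i) P.dom) fun w hw => hw.1 i
  · have hij := Finset.ne_of_mem_erase hj
    exact ContDiffOn.mul (by fun_prop) ((hP.contDiffOn_deriv_V hij).div (hP.contDiffOn_dist hij)
      fun w hw => (hP.dist_pos hw hij).ne')

theorem contDiffOn_k (hP : P.Admissible) (i : Fin n) : ContDiffOn ℝ 1 (fun w => P.k w i) P.dom := by
  have hΦ := hP.contDiffOn_Phi i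
  have hG := hP.contDiffOn_G i
  unfold k
  refine ((contDiffOn_const.add hΦ).sub hG).add (hP.f_contDiff.comp_contDiffOn
    (ContDiffOn.mul (ContDiffOn.neg (ContDiffOn.div (by fun_prop) (by fun_prop) fun w hw => ?_))
      (hΦ.sub hG)))
  exact (sub_pos.2 (hP.r_mul_ω_lt hw i)).ne'

theorem contDiffOn_F (hP : P.Admissible) (i : Fin n) : ContDiffOn ℝ 1 (fun w => P.F w i) P.dom := by
  have hc : ContDiffOn ℝ 1 (fun w : State n => w.r i * P.ω / Real.cos (w.s i)) P.dom :=
    ContDiffOn.div (by fun_prop) (by fun_prop) fun w hw => (hP.cos_pos hw i).ne'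
  unfold F
  exact ((hP.contDiffOn_k i).neg.mul (ContDiffOn.sub (by fun_prop) hc)).sub
    (hc.mul ((hP.contDiffOn_Phi i).sub (hP.contDiffOn_G i)))

theorem contDiffOn_a (hP : P.Admissible) (i : Fin n) :
    ContDiffOn ℝ 1 (fun w : State n => P.a (w.1 i) (w.2.2.1 i) (w.2.2.2 i)) P.dom := by
  unfold a
  refine ContDiffOn.add (ContDiffOn.add (ContDiffOn.mul (ContDiffOn.mul (ContDiffOn.sub
    contDiffOn_const (ContDiffOn.div contDiffOn_const (by fun_prop) fun w hw => ?_)) (by fun_prop))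
    (by fun_prop)) (ContDiffOn.mul contDiffOn_const (ContDiffOn.div (by fun_prop) (by fun_prop)
    fun w hw => ?_))) (ContDiffOn.div contDiffOn_const (by fun_prop) fun w hw => ?_)
  · exact (pow_pos (hP.r_pos hw i) 2).ne'
  · exact (hP.r_pos hw i).ne'
  · exact (pow_pos (sub_pos.2 (hP.cos_Θ_lt_cos (hw.2.1 i))) 2).ne'

theorem contDiffOn_sdot (hP : P.Admissible) (i : Fin n) :
    ContDiffOn ℝ 1 (fun w => P.sdot w i) P.Ω := by
  have hF := (hP.contDiffOn_F i).mono Ω_subset_dom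
  have hΛ := (hP.contDiffOn_Lam i).mono Ω_subset_dom
  have hM := (hP.contDiffOn_M i).mono Ω_subset_dom
  unfold sdot
  exact ContDiffOn.div (by fun_prop) ((hP.contDiffOn_a i).mono Ω_subset_dom)
    fun w hw => (hP.a_pos (Ω_subset_dom hw) i (hw.2.2.1 i).1.le).ne'

theorem contDiffOn_field (hP : P.Admissible) : ContDiffOn ℝ 1 P.field P.Ω := by
  refine ContDiffOn.prodMk (by fun_prop) (ContDiffOn.prodMk (contDiffOn_pi.2 fun i =>
    (hP.contDiffOn_angSpeed i).mono Ω_subset_dom) (ContDiffOn.prodMk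
    (contDiffOn_pi.2 fun i => hP.contDiffOn_sdot i) (contDiffOn_pi.2 fun i =>
    (hP.contDiffOn_F i).mono Ω_subset_dom)))

end Regularity

end Admissible

/-! ### Invariance under full turns and compactness modulo full turns. -/

section Shift

/-- Rotation of the individual vehicles by full turns. -/
noncomputable def shift (m : Fin n → ℤ) (w : State n) : State n :=
  (w.1, fun i => w.2.1 i + m i * (2 * Real.pi), w.2.2.1, w.2.2.2)

theorem shift_sub_shift (m : Fin n → ℤ) (w : State n) (i j : Fin n) :
    (shift m w).2.1 i - (shift m w).2.1 j
      = w.2.1 i - w.2.1 j + ((m i - m j : ℤ) : ℝ) * (2 * Real.pi) := by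
  simp only [shift]
  push_cast
  ring

theorem cos_shift (m : Fin n → ℤ) (w : State n) (i j : Fin n) :
    Real.cos ((shift m w).2.1 i - (shift m w).2.1 j) = Real.cos (w.2.1 i - w.2.1 j) := by
  rw [shift_sub_shift, Real.cos_add_int_mul_two_pi]

theorem sin_shift (m : Fin n → ℤ) (w : State n) (i j : Fin n) :
    Real.sin ((shift m w).2.1 i - (shift m w).2.1 j) = Real.sin (w.2.1 i - w.2.1 j) := by
  rw [shift_sub_shift, Real.sin_add_int_mul_two_pi]

variable (m : Fin n → ℤ) (w : State n) (i j : Fin n)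

theorem dist_shift : P.dist (shift m w) i j = P.dist w i j := by
  unfold dist
  rw [cos_shift]
  rfl

theorem Phi_shift : P.Phi (shift m w) i = P.Phi w i := by
  simp only [Phi, dist_shift, sin_shift]
  rfl

theorem G_shift : P.G (shift m w) i = P.G w i := by
  simp only [G, dist_shift]
  rfl

theorem M_shift : P.M (shift m w) i = P.M w i := by
  simp only [M, dist_shift]
  rfl

theorem Lam_shift : P.Lam (shift m w) i = P.Lam w i := by
  simp only [Lam, dist_shift, cos_shift]
  rfl

theorem k_shift : P.k (shift m w) i = P.k w i := by
  simp only [k, Phi_shift, G_shift]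
  rfl

theorem F_shift : P.F (shift m w) i = P.F w i := by
  simp only [F, k_shift, Phi_shift, G_shift]
  rfl

theorem sdot_shift : P.sdot (shift m w) i = P.sdot w i := by
  simp only [sdot, F_shift, Lam_shift, M_shift]
  rfl

end Shift

section Box

/-- States whose radii, orientations, speeds and mutual distances satisfy closed bounds. -/
def box (P : Params n) (ρ₁ ρ₂ : Fin n → ℝ) (θ : ℝ) (ℓ : Fin n → Fin n → ℝ) (m₁ m₂ : Fin n → ℝ) :
    Set (State n) :=
  {w | (∀ i, w.1 i ∈ Icc (ρ₁ i) (ρ₂ i)) ∧ (∀ i, w.2.2.1 i ∈ Icc (-θ) θ) ∧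
    (∀ i, w.2.2.2 i ∈ Icc (m₁ i) (m₂ i)) ∧ ∀ i j, j ≠ i → ℓ i j ≤ P.dist w i j}

variable {ρ₁ ρ₂ : Fin n → ℝ} {θ : ℝ} {ℓ : Fin n → Fin n → ℝ} {m₁ m₂ : Fin n → ℝ}

theorem shift_mem_box {w : State n} (hw : w ∈ P.box ρ₁ ρ₂ θ ℓ m₁ m₂) (m : Fin n → ℤ) :
    shift m w ∈ P.box ρ₁ ρ₂ θ ℓ m₁ m₂ :=
  ⟨hw.1, hw.2.1, hw.2.2.1, fun i j hij => (dist_shift m w i j).symm ▸ hw.2.2.2 i j hij⟩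

theorem isClosed_box : IsClosed (P.box ρ₁ ρ₂ θ ℓ m₁ m₂) := by
  simp only [box, ofPred_and, ofPred_forall]
  refine .inter (isClosed_iInter fun i => ?_) (.inter (isClosed_iInter fun i => ?_)
    (.inter (isClosed_iInter fun i => ?_) (isClosed_iInter fun i => isClosed_iInter fun j =>
      isClosed_iInter fun _ => isClosed_le continuous_const (continuous_dist i j))))
  · exact isClosed_Icc.preimage (by fun_prop : Continuous fun w : State n => w.1 i)
  · exact isClosed_Icc.preimage (by fun_prop : Continuous fun w : State n => w.2.2.1 i)
  · exact isClosed_Icc.preimage (by fun_prop : Continuous fun w : State n => w.2.2.2 i)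

theorem isCompact_box_inter (α β : Fin n → ℝ) :
    IsCompact (P.box ρ₁ ρ₂ θ ℓ m₁ m₂ ∩ {w | ∀ i, w.2.1 i ∈ Icc (α i) (β i)}) := by
  have hcl : IsClosed {w : State n | ∀ i, w.2.1 i ∈ Icc (α i) (β i)} := by
    simp only [ofPred_forall]
    exact isClosed_iInter fun i =>
      isClosed_Icc.preimage (by fun_prop : Continuous fun w : State n => w.2.1 i)
  refine (isCompact_Icc (a := ((ρ₁, α, fun _ => -θ, m₁) : State n))
    (b := (ρ₂, β, fun _ => θ, m₂))).of_isClosed_subset (isClosed_box.inter hcl) ?_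
  rintro w ⟨⟨h1, h2, h3, -⟩, h4⟩
  exact ⟨⟨fun i => (h1 i).1, fun i => (h4 i).1, fun i => (h2 i).1, fun i => (h3 i).1⟩,
    ⟨fun i => (h1 i).2, fun i => (h4 i).2, fun i => (h2 i).2, fun i => (h3 i).2⟩⟩

theorem exists_shift_mem_Ico (w : State n) :
    ∃ m : Fin n → ℤ, ∀ i, (shift m w).2.1 i ∈ Ico 0 (2 * Real.pi) := by
  choose m hm _ using fun i => existsUnique_add_zsmul_mem_Ico Real.two_pi_pos (w.2.1 i) 0
  refine ⟨m, fun i => ?_⟩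
  simpa [shift] using hm i

variable {S : Set (State n)} {g : State n → ℝ}

/-- The box is unbounded in the angles, but full turns bring every state into the compact part with
angles in `[0, 2π]`. -/
theorem exists_abs_le_of_shift (hg : ContinuousOn g S) (hS : P.box ρ₁ ρ₂ θ ℓ m₁ m₂ ⊆ S)
    (hinv : ∀ m w, g (shift m w) = g w) :
    ∃ C, ∀ w ∈ P.box ρ₁ ρ₂ θ ℓ m₁ m₂, |g w| ≤ C := by
  obtain ⟨C, hC⟩ := (isCompact_box_inter (P := P) (ρ₁ := ρ₁) (ρ₂ := ρ₂) (θ := θ) (ℓ := ℓ)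
    (m₁ := m₁) (m₂ := m₂) (fun _ => 0) (fun _ => 2 * Real.pi)).exists_bound_of_continuousOn
    (hg.mono (inter_subset_left.trans hS))
  refine ⟨C, fun w hw => ?_⟩
  obtain ⟨m, hm⟩ := exists_shift_mem_Ico w
  rw [← hinv m w]
  exact hC _ ⟨shift_mem_box hw m, fun i => Ico_subset_Icc_self (hm i)⟩

theorem uniformContinuousOn_of_shift (hg : ContinuousOn g S) (hS : P.box ρ₁ ρ₂ θ ℓ m₁ m₂ ⊆ S)
    (hinv : ∀ m w, g (shift m w) = g w) :
    UniformContinuousOn g (P.box ρ₁ ρ₂ θ ℓ m₁ m₂) := by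
  -- One shift must serve both points in order to preserve their distance. It normalizes the angles
  -- of `x` to `[0, 2π)`; the margin `1` on both sides accommodates those of `y`.
  have hu := (isCompact_box_inter (P := P) (ρ₁ := ρ₁) (ρ₂ := ρ₂) (θ := θ) (ℓ := ℓ)
    (m₁ := m₁) (m₂ := m₂) (fun _ => -1)
    (fun _ => 2 * Real.pi + 1)).uniformContinuousOn_of_continuous
    (hg.mono (inter_subset_left.trans hS))
  rw [Metric.uniformContinuousOn_iff] at hu ⊢
  intro ε hε
  obtain ⟨d, hd, h⟩ := hu ε hε
  refine ⟨min d 1, lt_min hd one_pos, fun x hx y hy hxy => ?_⟩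
  obtain ⟨m, hm⟩ := exists_shift_mem_Ico x
  rw [← hinv m x, ← hinv m y]
  have hxy' : Dist.dist (shift m x) (shift m y) = Dist.dist x y := by
    have h2 : Dist.dist (shift m x).2.1 (shift m y).2.1 = Dist.dist x.2.1 y.2.1 :=
      dist_add_right x.2.1 y.2.1 fun i => m i * (2 * Real.pi)
    rw [Prod.dist_eq, Prod.dist_eq (x := (shift m x).2), h2]
    rfl
  refine h _ ⟨shift_mem_box hx m, fun i => ?_⟩ _ ⟨shift_mem_box hy m, fun i => ?_⟩
    (hxy' ▸ hxy.trans_le (min_le_left _ _))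
  · exact ⟨by linarith [(hm i).1], by linarith [(hm i).2]⟩
  · have h1 : Dist.dist ((shift m x).2.1 i) ((shift m y).2.1 i)
        ≤ Dist.dist (shift m x) (shift m y) :=
      (dist_le_pi_dist _ _ i).trans ((le_max_left _ _).trans (le_max_right _ _))
    rw [hxy', Real.dist_eq] at h1
    have h3 := abs_lt.1 (h1.trans_lt (hxy.trans_le (min_le_right _ _)))
    exact ⟨by linarith [(hm i).1], by linarith [(hm i).2]⟩

end Box

end Params

end RingRoad

namespace RingRoad

/-! ### The derivative of `H` along solutions. -/

theorem sum_erase_comm {n : ℕ} (f : Fin n → Fin n → ℝ) :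
    ∑ i, ∑ j ∈ Finset.univ.erase i, f i j = ∑ i, ∑ j ∈ Finset.univ.erase i, f j i :=
  Finset.sum_comm' fun i j => by simp [ne_comm]

theorem half_sum_erase_add {n : ℕ} (f : Fin n → Fin n → ℝ) :
    1 / 2 * ∑ i, ∑ j ∈ Finset.univ.erase i, (f i j + f j i)
      = ∑ i, ∑ j ∈ Finset.univ.erase i, f i j := by
  simp only [Finset.sum_add_distrib]
  rw [← sum_erase_comm f]
  ring

/-- A symmetric viscous interaction is dissipative. -/
theorem sum_viscous_nonpos {n : ℕ} {q : Fin n → Fin n → ℝ} {g : ℝ → ℝ} (hg : Monotone g)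
    (hq : ∀ i j, i ≠ j → 0 ≤ q i j) (hq' : ∀ i j, i ≠ j → q i j = q j i) (x : Fin n → ℝ) (c : ℝ) :
    ∑ i, (∑ j ∈ Finset.univ.erase i, q i j * (g (x j) - g (x i))) * (x i - c) ≤ 0 := by
  simp only [Finset.sum_mul]
  -- Pairing `(i, j)` with `(j, i)` removes `c` and leaves products of increments of `g` and of `x`,
  -- which have equal signs by monotonicity.
  rw [← half_sum_erase_add]
  refine mul_nonpos_of_nonneg_of_nonpos (by norm_num)
    (Finset.sum_nonpos fun i _ => Finset.sum_nonpos fun j hj => ?_)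
  have hij : i ≠ j := (Finset.ne_of_mem_erase hj).symm
  have h : q i j * (g (x j) - g (x i)) * (x i - c) + q j i * (g (x i) - g (x j)) * (x j - c)
      = -(q i j * ((g (x i) - g (x j)) * (x i - x j))) := by
    rw [← hq' i j hij]
    ring
  rw [h, neg_nonpos]
  refine mul_nonneg (hq i j hij) ?_
  rcases le_total (x i) (x j) with hx | hx
  · exact mul_nonneg_of_nonpos_of_nonpos (sub_nonpos.2 (hg hx)) (sub_nonpos.2 hx)
  · exact mul_nonneg (sub_nonneg.2 (hg hx)) (sub_nonneg.2 hx)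

namespace Params

variable {n : ℕ} {P : Params n}

theorem dist_comm (hP : P.Admissible) (w : State n) (i j : Fin n) :
    P.dist w i j = P.dist w j i := by
  unfold dist
  rw [hP.p_symm i j, ← Real.cos_neg (w.φ i - w.φ j), neg_sub]
  congr 1
  ring

/-- The derivative of the angular speed along solutions. -/
noncomputable def angAcc (P : Params n) (w : State n) (i : Fin n) : ℝ :=
  P.F w i / w.1 i * Real.cos (w.2.2.1 i)
    + w.2.2.2 i ^ 2 * Real.sin (w.2.2.1 i) * Real.cos (w.2.2.1 i) / w.1 i ^ 2
    - w.2.2.2 i / w.1 i * Real.sin (w.2.2.1 i) * P.sdot w i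

/-- The derivative of `H` along solutions. -/
noncomputable def Hdot (P : Params n) (w : State n) : ℝ :=
  ∑ i, (-P.k w i * (angSpeed w i - P.ω) ^ 2 + P.ω * P.G w i * (angSpeed w i - P.ω)
    - P.μ₂ * Real.sin (w.2.2.1 i) ^ 2 + P.M w i * Real.sin (w.2.2.1 i))

section Derivatives

variable {w : ℝ → State n} {I : Set ℝ} {t : ℝ}

theorem hasDerivWithinAt_r (hw : HasDerivWithinAt w (P.field (w t)) I t) (i : Fin n) :
    HasDerivWithinAt (fun τ => (w τ).1 i)
    (-(w t).2.2.2 i * Real.sin ((w t).2.2.1 i)) I t :=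
  hasDerivWithinAt_pi.1 (hasFDerivAt_fst.comp_hasDerivWithinAt t hw) i

theorem hasDerivWithinAt_φ (hw : HasDerivWithinAt w (P.field (w t)) I t) (i : Fin n) :
    HasDerivWithinAt (fun τ => (w τ).2.1 i)
    (angSpeed (w t) i) I t :=
  hasDerivWithinAt_pi.1 (hasFDerivAt_fst.comp_hasDerivWithinAt t
    (hasFDerivAt_snd.comp_hasDerivWithinAt t hw)) i

theorem hasDerivWithinAt_s (hw : HasDerivWithinAt w (P.field (w t)) I t) (i : Fin n) :
    HasDerivWithinAt (fun τ => (w τ).2.2.1 i)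
    (P.sdot (w t) i) I t :=
  hasDerivWithinAt_pi.1 (hasFDerivAt_fst.comp_hasDerivWithinAt t
    (hasFDerivAt_snd.comp_hasDerivWithinAt t (hasFDerivAt_snd.comp_hasDerivWithinAt t hw))) i

theorem hasDerivWithinAt_v (hw : HasDerivWithinAt w (P.field (w t)) I t) (i : Fin n) :
    HasDerivWithinAt (fun τ => (w τ).2.2.2 i)
    (P.F (w t) i) I t :=
  hasDerivWithinAt_pi.1 (hasFDerivAt_snd.comp_hasDerivWithinAt t
    (hasFDerivAt_snd.comp_hasDerivWithinAt t (hasFDerivAt_snd.comp_hasDerivWithinAt t hw))) i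

theorem hasDerivWithinAt_angSpeed (hw : HasDerivWithinAt w (P.field (w t)) I t)
    (hP : P.Admissible) (hwt : w t ∈ P.dom) (i : Fin n) :
    HasDerivWithinAt (fun τ => angSpeed (w τ) i) (P.angAcc (w t) i) I t := by
  have hr := (hP.r_pos hwt i).ne'
  have h := ((hasDerivWithinAt_v hw i).div (hasDerivWithinAt_r hw i) hr).mul
    (hasDerivWithinAt_s hw i).cos
  refine h.congr_deriv ?_
  simp only [angAcc, Pi.div_apply]
  field_simp
  ring

/-- The terms are grouped so that the coefficients of the radial velocities are those occurring in
`Lam`, and that of the relative angular speed is the one in `Phi`. -/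
theorem hasDerivWithinAt_dist (hw : HasDerivWithinAt w (P.field (w t)) I t) (hP : P.Admissible)
    (hwt : w t ∈ P.dom) {i j : Fin n}
    (hij : j ≠ i) :
    HasDerivWithinAt (fun τ => P.dist (w τ) i j)
      (((P.p i j * ((w t).1 i - (w t).1 j)
            + (w t).1 j * (1 - Real.cos ((w t).2.1 i - (w t).2.1 j)))
          * (-(w t).2.2.2 i * Real.sin ((w t).2.2.1 i))
        + (P.p i j * ((w t).1 j - (w t).1 i)
            + (w t).1 i * (1 - Real.cos ((w t).2.1 i - (w t).2.1 j)))
          * (-(w t).2.2.2 j * Real.sin ((w t).2.2.1 j))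
        + (w t).1 i * (w t).1 j * Real.sin ((w t).2.1 i - (w t).2.1 j)
          * (angSpeed (w t) i - angSpeed (w t) j)) / P.dist (w t) i j) I t := by
  have hd := hP.dist_pos hwt hij
  have hri := hasDerivWithinAt_r hw i
  have hrj := hasDerivWithinAt_r hw j
  have hφ := ((hasDerivWithinAt_φ hw i).sub (hasDerivWithinAt_φ hw j)).cos.const_sub 1
  have h := ((((hri.sub hrj).pow 2).const_mul (P.p i j)).add
    (((hri.const_mul 2).mul hrj).mul hφ)).sqrt (Real.sqrt_pos.1 hd).ne'
  refine h.congr_deriv ?_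
  simp only [Pi.add_apply, Pi.sub_apply, Pi.mul_apply, Pi.pow_apply]
  rw [← dist]
  field_simp
  ring

end Derivatives

theorem deriv_V_symm (hP : P.Admissible) {w : State n} (hw : w ∈ P.dom) {i j : Fin n}
    (hij : j ≠ i) :
    deriv (P.V i j) (P.dist w i j) = deriv (P.V j i) (P.dist w j i) := by
  rw [dist_comm hP w j i]
  refine Filter.EventuallyEq.deriv_eq ?_
  filter_upwards [Ioi_mem_nhds (hw.2.2 i j hij)] with d hd
  exact hP.V_symm i j hij.symm d hd

theorem hasDerivWithinAt_U (hP : P.Admissible) {w : ℝ → State n} {I : Set ℝ} {t : ℝ}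
    (hw : HasDerivWithinAt w (P.field (w t)) I t) (hwt : w t ∈ P.dom) (i : Fin n) :
    HasDerivWithinAt (fun τ => P.U i ((w τ).1 i))
      (deriv (P.U i) ((w t).1 i) * (-(w t).2.2.2 i * Real.sin ((w t).2.2.1 i))) I t := by
  have hU : HasDerivAt (P.U i) (deriv (P.U i) ((w t).1 i)) ((w t).1 i) :=
    (((hP.U_contDiff i).differentiableOn two_ne_zero).differentiableAt
      (isOpen_Ioo.mem_nhds (hwt.1 i))).hasDerivAt
  exact hU.comp_hasDerivWithinAt t (hasDerivWithinAt_r hw i)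

theorem omega_mul_Phi (hP : P.Admissible) (w : State n) (i : Fin n) :
    P.ω * P.Phi w i = ∑ j ∈ Finset.univ.erase i, deriv (P.V i j) (P.dist w i j) / P.dist w i j
      * (w.1 i * w.1 j * Real.sin (w.2.1 i - w.2.1 j)) := by
  rw [Phi, ← mul_assoc, mul_div_cancel₀ _ hP.ω_pos.ne', Finset.mul_sum]
  exact Finset.sum_congr rfl fun j _ => by ring

/-- The interaction forces are internal: they add up to zero. -/
theorem sum_omega_mul_Phi (hP : P.Admissible) {w : State n} (hw : w ∈ P.dom) :
    ∑ i, P.ω * P.Phi w i = 0 := by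
  simp only [omega_mul_Phi hP]
  rw [← half_sum_erase_add]
  refine mul_eq_zero_of_right _ (Finset.sum_eq_zero fun i _ => Finset.sum_eq_zero fun j hj => ?_)
  rw [← deriv_V_symm hP hw (Finset.ne_of_mem_erase hj), dist_comm hP w j i,
    ← neg_sub (w.2.1 i), Real.sin_neg]
  ring

theorem hasDerivWithinAt_interaction (hP : P.Admissible) {w : ℝ → State n} {I : Set ℝ} {t : ℝ}
    (hw : HasDerivWithinAt w (P.field (w t)) I t) (hwt : w t ∈ P.dom) :
    HasDerivWithinAt
      (fun τ => 1 / 2 * ∑ i, ∑ j ∈ Finset.univ.erase i, P.V i j (P.dist (w τ) i j))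
      (∑ i, ((∑ j ∈ Finset.univ.erase i,
        (P.p i j * ((w t).1 i - (w t).1 j)
          + (w t).1 j * (1 - Real.cos ((w t).2.1 i - (w t).2.1 j)))
          * (deriv (P.V i j) (P.dist (w t) i j) / P.dist (w t) i j))
          * (-(w t).2.2.2 i * Real.sin ((w t).2.2.1 i))
        + P.ω * P.Phi (w t) i * (angSpeed (w t) i - P.ω))) I t := by
  have hV : ∀ i, ∀ j ∈ Finset.univ.erase i, HasDerivWithinAt
      (fun τ => P.V i j (P.dist (w τ) i j)) _ I t := fun i j hj => by
    have hij := Finset.ne_of_mem_erase hj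
    exact HasDerivAt.comp_hasDerivWithinAt t
      (((hP.V_contDiff i j hij.symm).differentiableOn two_ne_zero).differentiableAt
        (isOpen_Ioi.mem_nhds (hwt.2.2 i j hij))).hasDerivAt (hasDerivWithinAt_dist hw hP hwt hij)
  refine ((HasDerivWithinAt.fun_sum fun i _ => HasDerivWithinAt.fun_sum (hV i)).const_mul
    (1 / 2)).congr_deriv ?_
  -- As the internal forces sum to zero, subtracting the common speed `ω` costs nothing.
  have hsplit : ∑ i, P.ω * P.Phi (w t) i * (angSpeed (w t) i - P.ω)
      = ∑ i, P.ω * P.Phi (w t) i * angSpeed (w t) i := by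
    simp only [mul_sub, Finset.sum_sub_distrib, ← Finset.sum_mul, sum_omega_mul_Phi hP hwt]
    ring
  rw [Finset.sum_add_distrib, hsplit, ← Finset.sum_add_distrib]
  simp only [omega_mul_Phi hP, Finset.sum_mul, ← Finset.sum_add_distrib]
  refine Eq.trans ?_ (half_sum_erase_add _)
  congr 1
  refine Finset.sum_congr rfl fun i _ => Finset.sum_congr rfl fun j hj => ?_
  rw [← deriv_V_symm hP hwt (Finset.ne_of_mem_erase hj), dist_comm hP (w t) j i,
    ← neg_sub ((w t).2.1 i), Real.sin_neg, Real.cos_neg, hP.p_symm j i]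
  ring

/-- This is where the design of the controller enters. The relation for `F cos s / r`, multiplied by
the angular speed error, cancels the interaction term with `Phi`; the relation for `a * sdot`,
multiplied by `sin s`, cancels all radial forces and the barrier term. -/
theorem dissipation_identity (hP : P.Admissible) {w : State n} (hw : w ∈ P.Ω) (i : Fin n) :
    (angSpeed w i - P.ω) * P.angAcc w i
      + P.b * (w.2.2.2 i * P.F w i * Real.sin (w.2.2.1 i) ^ 2
        + w.2.2.2 i ^ 2 * Real.sin (w.2.2.1 i) * Real.cos (w.2.2.1 i) * P.sdot w i)
      + deriv (P.U i) (w.1 i) * (-w.2.2.2 i * Real.sin (w.2.2.1 i))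
      + ((∑ j ∈ Finset.univ.erase i,
        (P.p i j * (w.1 i - w.1 j) + w.1 j * (1 - Real.cos (w.2.1 i - w.2.1 j)))
          * (deriv (P.V i j) (P.dist w i j) / P.dist w i j))
          * (-w.2.2.2 i * Real.sin (w.2.2.1 i))
        + P.ω * P.Phi w i * (angSpeed w i - P.ω))
      + P.A * (Real.sin (w.2.2.1 i) * P.sdot w i / (Real.cos (w.2.2.1 i) - Real.cos P.Θ) ^ 2)
    = -P.k w i * (angSpeed w i - P.ω) ^ 2 + P.ω * P.G w i * (angSpeed w i - P.ω)
      - P.μ₂ * Real.sin (w.2.2.1 i) ^ 2 + P.M w i * Real.sin (w.2.2.1 i) := by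
  have hd := Ω_subset_dom hw
  have ha := hP.a_pos hd i (hw.2.2.1 i).1.le
  have hr := hP.r_pos hd i
  have hc := hP.cos_pos hd i
  have hF : P.F w i / w.1 i * Real.cos (w.2.2.1 i)
      = -P.k w i * (angSpeed w i - P.ω) - P.ω * (P.Phi w i - P.G w i) := by
    simp only [F, angSpeed]
    field_simp
  have hs : P.sdot w i * P.a (w.1 i) (w.2.2.1 i) (w.2.2.2 i)
      = -(P.μ₂ * Real.sin (w.2.2.1 i)
        + (P.b * P.F w i * Real.sin (w.2.2.1 i) + P.Lam w i) * w.2.2.2 i - P.M w i) := by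
    rw [sdot, div_mul_cancel₀ _ ha.ne']
  simp only [a, Lam] at hs
  simp only [angAcc]
  simp only [angSpeed] at hF ⊢
  linear_combination (w.2.2.2 i / w.1 i * Real.cos (w.2.2.1 i) - P.ω) * hF
    + Real.sin (w.2.2.1 i) * hs

theorem hasDerivWithinAt_H (hP : P.Admissible) {w : ℝ → State n} {I : Set ℝ} {t : ℝ}
    (hw : HasDerivWithinAt w (P.field (w t)) I t) (hwt : w t ∈ P.Ω) :
    HasDerivWithinAt (fun τ => P.H (w τ)) (P.Hdot (w t)) I t := by
  have hd := Ω_subset_dom hwt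
  have h1 : ∀ i ∈ Finset.univ, HasDerivWithinAt _ _ I t := fun i _ =>
    ((hasDerivWithinAt_angSpeed hw hP hd i).sub_const P.ω).fun_pow 2
  have h2 : ∀ i ∈ Finset.univ, HasDerivWithinAt _ _ I t := fun i _ =>
    ((hasDerivWithinAt_v hw i).fun_pow 2).fun_mul ((hasDerivWithinAt_s hw i).sin.fun_pow 2)
  have h3 : ∀ i ∈ Finset.univ, HasDerivWithinAt _ _ I t := fun i _ =>
    hasDerivWithinAt_U hP hw hd i
  have h5 : ∀ i ∈ Finset.univ, HasDerivWithinAt _ _ I t := fun i _ =>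
    (((hasDerivWithinAt_s hw i).cos.sub_const (Real.cos P.Θ)).fun_inv
      (sub_pos.2 (hP.cos_Θ_lt_cos (hd.2.1 i))).ne').sub_const (1 / (1 - Real.cos P.Θ))
  have h := (((((HasDerivWithinAt.fun_sum h1).const_mul (1 / 2)).fun_add
    ((HasDerivWithinAt.fun_sum h2).const_mul (P.b / 2))).fun_add
    (HasDerivWithinAt.fun_sum h3)).fun_add (hasDerivWithinAt_interaction hP hw hd)).fun_add
    ((HasDerivWithinAt.fun_sum h5).const_mul P.A)
  refine (h.congr_deriv ?_).congr (fun τ _ => ?_) ?_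
  · simp only [Hdot, Finset.mul_sum]
    rw [← Finset.sum_add_distrib, ← Finset.sum_add_distrib, ← Finset.sum_add_distrib,
      ← Finset.sum_add_distrib]
    refine Finset.sum_congr rfl fun i _ => ?_
    rw [← dissipation_identity hP hwt i]
    ring
  · simp only [H, angSpeed, one_div]
  · simp only [H, angSpeed, one_div]

/-- Put `Z = Φ - G`. If `0 ≤ Z`, then `0 ≤ f` suffices. If `Z ≤ 0`, then `f` is at least `-Z` times
a factor which is at least `1`, and this compensates `Z`. -/
theorem mu_le_k (hP : P.Admissible) {w : State n} (hw : w ∈ P.dom) (i : Fin n) :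
    P.μ₁ ≤ P.k w i := by
  have hc := hP.cos_pos hw i
  have hq := sub_pos.2 (hP.r_mul_ω_lt hw i)
  have h1 : 1 ≤ P.vmax * Real.cos (w.2.2.1 i)
      / (P.vmax * Real.cos (w.2.2.1 i) - w.1 i * P.ω) := by
    rw [one_le_div hq]
    linarith [mul_pos (hP.r_pos hw i) hP.ω_pos]
  have h2 := hP.le_f (-(P.vmax * Real.cos (w.2.2.1 i)
      / (P.vmax * Real.cos (w.2.2.1 i) - w.1 i * P.ω)) * (P.Phi w i - P.G w i))
  have h3 := (le_max_left _ _).trans h2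
  have h4 := (le_max_right _ _).trans h2
  unfold k
  rcases le_total 0 (P.Phi w i - P.G w i) with hZ | hZ
  · linarith
  · nlinarith

theorem Hdot_le (hP : P.Admissible) {w : State n} (hw : w ∈ P.dom) :
    P.Hdot w ≤ -∑ i, (P.μ₁ * (angSpeed w i - P.ω) ^ 2 + P.μ₂ * Real.sin (w.2.2.1 i) ^ 2) := by
  have hκ : ∀ i j : Fin n, i ≠ j → 0 ≤ P.κ i j (P.dist w i j) := fun i j hij =>
    hP.κ_nonneg i j hij _ (hw.2.2 i j hij.symm)
  have hκ' : ∀ i j : Fin n, i ≠ j → P.κ i j (P.dist w i j) = P.κ j i (P.dist w j i) :=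
    fun i j hij => by
      rw [dist_comm hP w j i]
      exact hP.κ_symm i j hij _ (hw.2.2 i j hij.symm)
  have hG := sum_viscous_nonpos hP.g₁_mono hκ hκ' (angSpeed w) P.ω
  have hM := sum_viscous_nonpos hP.g₂_mono hκ hκ' (fun i => Real.sin (w.2.2.1 i)) 0
  have hG' : ∑ i, P.ω * P.G w i * (angSpeed w i - P.ω) ≤ 0 := by
    refine le_of_eq_of_le (Finset.sum_congr rfl fun i _ => ?_) hG
    rw [G, ← mul_assoc, mul_one_div_cancel hP.ω_pos.ne', one_mul]
    rfl
  have hM' : ∑ i, P.M w i * Real.sin (w.2.2.1 i) ≤ 0 := by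
    simp only [sub_zero] at hM
    exact hM
  have hk : ∑ i, -P.k w i * (angSpeed w i - P.ω) ^ 2 ≤ ∑ i, -P.μ₁ * (angSpeed w i - P.ω) ^ 2 :=
    Finset.sum_le_sum fun i _ =>
      mul_le_mul_of_nonneg_right (neg_le_neg (mu_le_k hP hw i)) (sq_nonneg _)
  simp only [Hdot, Finset.sum_add_distrib, Finset.sum_sub_distrib, neg_mul,
    Finset.sum_neg_distrib] at hk ⊢
  linarith

theorem Hdot_nonpos (hP : P.Admissible) {w : State n} (hw : w ∈ P.dom) : P.Hdot w ≤ 0 := by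
  refine (Hdot_le hP hw).trans (neg_nonpos.2 (Finset.sum_nonneg fun i _ => ?_))
  have := hP.μ₁_pos
  have := hP.μ₂_pos
  positivity

theorem potentials_le_H (hP : P.Admissible) (w : State n) :
    (∑ i, P.U i (w.1 i)) + 1 / 2 * ∑ i, ∑ j ∈ Finset.univ.erase i, P.V i j (P.dist w i j)
      + P.A * ∑ i, (1 / (Real.cos (w.2.2.1 i) - Real.cos P.Θ) - 1 / (1 - Real.cos P.Θ))
      ≤ P.H w := by
  have h1 : 0 ≤ ∑ i, (w.2.2.2 i / w.1 i * Real.cos (w.2.2.1 i) - P.ω) ^ 2 :=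
    Finset.sum_nonneg fun i _ => sq_nonneg _
  have h2 : 0 ≤ P.b / 2 * ∑ i, w.2.2.2 i ^ 2 * Real.sin (w.2.2.1 i) ^ 2 := by
    have : 0 < P.b := lt_trans (by have := hP.Rin_pos; positivity) hP.lt_b
    exact mul_nonneg (by positivity) (Finset.sum_nonneg fun i _ => by positivity)
  unfold H
  linarith

/-! ### Confinement by the sublevel sets of `H`. -/

section Sublevel

variable {w : State n}

theorem barrier_nonneg (hP : P.Admissible) (hw : w ∈ P.dom) (i : Fin n) :
    0 ≤ 1 / (Real.cos (w.2.2.1 i) - Real.cos P.Θ) - 1 / (1 - Real.cos P.Θ) :=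
  sub_nonneg.2 (one_div_le_one_div_of_le (sub_pos.2 (hP.cos_Θ_lt_cos (hw.2.1 i)))
    (sub_le_sub_right (Real.cos_le_one _) _))

theorem V_dist_nonneg (hP : P.Admissible) (hw : w ∈ P.dom) (i : Fin n) {j : Fin n}
    (hj : j ∈ Finset.univ.erase i) :
    0 ≤ P.V i j (P.dist w i j) :=
  hP.V_nonneg i j (Finset.ne_of_mem_erase hj).symm _ (hw.2.2 i j (Finset.ne_of_mem_erase hj))

theorem sum_U_nonneg (hP : P.Admissible) (hw : w ∈ P.dom) : 0 ≤ ∑ i, P.U i (w.1 i) :=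
  Finset.sum_nonneg fun i _ => hP.U_nonneg i _ (hw.1 i)

theorem sum_V_nonneg (hP : P.Admissible) (hw : w ∈ P.dom) :
    0 ≤ ∑ i, ∑ j ∈ Finset.univ.erase i, P.V i j (P.dist w i j) :=
  Finset.sum_nonneg fun i _ => Finset.sum_nonneg fun _ hj => V_dist_nonneg hP hw i hj

theorem sum_barrier_nonneg (hP : P.Admissible) (hw : w ∈ P.dom) :
    0 ≤ P.A * ∑ i, (1 / (Real.cos (w.2.2.1 i) - Real.cos P.Θ) - 1 / (1 - Real.cos P.Θ)) :=
  mul_nonneg hP.A_pos.le (Finset.sum_nonneg fun i _ => barrier_nonneg hP hw i)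

theorem H_nonneg (hP : P.Admissible) (hw : w ∈ P.dom) : 0 ≤ P.H w := by
  linarith [potentials_le_H hP w, sum_U_nonneg hP hw, sum_V_nonneg hP hw,
    sum_barrier_nonneg hP hw]

theorem U_le_H (hP : P.Admissible) (hw : w ∈ P.dom) (i : Fin n) : P.U i (w.1 i) ≤ P.H w := by
  have := Finset.single_le_sum (fun i _ => hP.U_nonneg i _ (hw.1 i)) (Finset.mem_univ i)
  linarith [potentials_le_H hP w, sum_V_nonneg hP hw, sum_barrier_nonneg hP hw]

/-- The factor `2` undoes the `1 / 2` in `H`, since only one of the two ordered pairs is kept. -/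
theorem V_le_two_mul_H (hP : P.Admissible) (hw : w ∈ P.dom) {i j : Fin n} (hij : j ≠ i) :
    P.V i j (P.dist w i j) ≤ 2 * P.H w := by
  have h1 := Finset.single_le_sum (fun j hj => V_dist_nonneg hP hw i hj)
    (Finset.mem_erase.2 ⟨hij, Finset.mem_univ j⟩)
  have h2 := Finset.single_le_sum (f := fun i => ∑ j ∈ Finset.univ.erase i, P.V i j (P.dist w i j))
    (fun i _ => Finset.sum_nonneg fun _ hj => V_dist_nonneg hP hw i hj) (Finset.mem_univ i)
  linarith [potentials_le_H hP w, sum_U_nonneg hP hw, sum_barrier_nonneg hP hw]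

theorem barrier_le_H (hP : P.Admissible) (hw : w ∈ P.dom) (i : Fin n) :
    P.A * (1 / (Real.cos (w.2.2.1 i) - Real.cos P.Θ) - 1 / (1 - Real.cos P.Θ)) ≤ P.H w := by
  have h1 := mul_le_mul_of_nonneg_left (Finset.single_le_sum
    (fun i _ => barrier_nonneg hP hw i) (Finset.mem_univ i)) hP.A_pos.le
  linarith [potentials_le_H hP w, sum_U_nonneg hP hw, sum_V_nonneg hP hw]

end Sublevel

theorem tendsto_barrier (hP : P.Admissible) :
    Tendsto (fun x => P.A * (1 / (Real.cos x - Real.cos P.Θ) - 1 / (1 - Real.cos P.Θ)))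
      (𝓝[<] P.Θ) atTop := by
  have h0 : Tendsto (fun x => Real.cos x - Real.cos P.Θ) (𝓝[<] P.Θ) (𝓝[>] 0) := by
    refine tendsto_nhdsWithin_iff.2 ⟨?_, ?_⟩
    · have : Continuous fun x => Real.cos x - Real.cos P.Θ := by fun_prop
      have h := this.tendsto P.Θ
      rw [sub_self] at h
      exact h.mono_left nhdsWithin_le_nhds
    · filter_upwards [Ioo_mem_nhdsLT (show -P.Θ < P.Θ by linarith [hP.Θ_pos])] with x hx
      exact sub_pos.2 (hP.cos_Θ_lt_cos hx)
  have h1 := tendsto_inv_nhdsGT_zero.comp h0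
  refine Tendsto.const_mul_atTop hP.A_pos ?_
  simp only [one_div, sub_eq_add_neg]
  exact tendsto_atTop_add_const_right _ _ h1

/-- The sublevel sets of `H` stay away from the boundary of the state space in all components
but the speeds. -/
theorem exists_sublevel_subset_box (hP : P.Admissible) (h : ℝ) :
    ∃ (ρ₁ ρ₂ : Fin n → ℝ) (θ : ℝ) (ℓ : Fin n → Fin n → ℝ),
      (∀ m₁ m₂, P.box ρ₁ ρ₂ θ ℓ m₁ m₂ ⊆ P.dom) ∧
      ∀ m₁ m₂, ∀ w ∈ P.dom, P.H w ≤ h → (∀ i, w.2.2.2 i ∈ Icc (m₁ i) (m₂ i)) →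
        w ∈ P.box ρ₁ ρ₂ θ ℓ m₁ m₂ := by
  choose ρ₁ hρ₁ hρ₁' using fun i => mem_nhdsGT_iff_exists_Ioo_subset.1
    ((hP.U_tendsto_in i).eventually_gt_atTop h)
  choose ρ₂ hρ₂ hρ₂' using fun i => mem_nhdsLT_iff_exists_Ioo_subset.1
    ((hP.U_tendsto_out i).eventually_gt_atTop h)
  obtain ⟨θ, hθ, hθ'⟩ := mem_nhdsLT_iff_exists_Ioo_subset.1
    ((tendsto_barrier hP).eventually_gt_atTop h)
  -- Values of `ℓ` on the diagonal are arbitrary; the box never refers to them.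
  choose! ℓ hℓ hℓ' using fun (i j : Fin n) (hij : i ≠ j) => mem_nhdsGT_iff_exists_Ioo_subset.1
    ((hP.V_tendsto i j hij).eventually_gt_atTop (2 * h))
  have hθΘ : θ < P.Θ := hθ
  refine ⟨ρ₁, ρ₂, θ, ℓ, fun m₁ m₂ w hw => ?_, fun m₁ m₂ w hw hH hv => ?_⟩
  · exact ⟨fun i => ⟨lt_of_lt_of_le (hρ₁ i) (hw.1 i).1, lt_of_le_of_lt (hw.1 i).2 (hρ₂ i)⟩,
      fun i => ⟨by linarith [(hw.2.1 i).1], by linarith [(hw.2.1 i).2]⟩,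
      fun i j hij => lt_of_lt_of_le (hℓ i j hij.symm) (hw.2.2.2 i j hij)⟩
  · refine ⟨fun i => ⟨?_, ?_⟩, fun i => abs_le.1 ?_, hv, fun i j hij => ?_⟩
    · by_contra! hc
      exact ((hρ₁' i ⟨(hw.1 i).1, hc⟩ : h < _).trans_le (U_le_H hP hw i)).not_ge hH
    · by_contra! hc
      exact ((hρ₂' i ⟨hc, (hw.1 i).2⟩ : h < _).trans_le (U_le_H hP hw i)).not_ge hH
    · by_contra! hc
      have h1 : h < _ := hθ' ⟨hc, abs_lt.2 (hw.2.1 i)⟩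
      rw [Real.cos_abs] at h1
      exact (h1.trans_le (barrier_le_H hP hw i)).not_ge hH
    · by_contra! hc
      have h1 : 2 * h < _ := hℓ' i j hij.symm ⟨hw.2.2 i j hij, hc⟩
      linarith [V_le_two_mul_H hP hw hij]

/-! ### Bounds on the speeds and global existence. -/

/-- The acceleration is bounded on sublevel sets of `H`. -/
theorem exists_abs_F_le (hP : P.Admissible) (h : ℝ) :
    ∃ C, ∀ w ∈ P.Ω, P.H w ≤ h → ∀ i, |P.F w i| ≤ C := by
  obtain ⟨ρ₁, ρ₂, θ, ℓ, hsub, hbox⟩ := exists_sublevel_subset_box hP h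
  -- The closed speed range `[0, vmax]` is allowed because `F` is continuous on `dom`.
  choose C hC using fun i => exists_abs_le_of_shift (hP.contDiffOn_F i).continuousOn
    (hsub (fun _ => 0) fun _ => P.vmax) fun m w => F_shift m w i
  refine ⟨∑ i, |C i|, fun w hw hH i => ((hC i w (hbox _ _ w (Ω_subset_dom hw) hH fun i =>
    Ioo_subset_Icc_self (hw.2.2.1 i))).trans (le_abs_self _)).trans ?_⟩
  exact Finset.single_le_sum (fun i _ => abs_nonneg (C i)) (Finset.mem_univ i)

theorem exists_k_le (hP : P.Admissible) (h : ℝ) :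
    ∃ C, 0 < C ∧ ∀ w ∈ P.Ω, P.H w ≤ h → ∀ i, P.k w i ≤ C := by
  obtain ⟨ρ₁, ρ₂, θ, ℓ, hsub, hbox⟩ := exists_sublevel_subset_box hP h
  choose C hC using fun i => exists_abs_le_of_shift (hP.contDiffOn_k i).continuousOn
    (hsub (fun _ => 0) fun _ => P.vmax) fun m w => k_shift m w i
  refine ⟨1 + ∑ i, |C i|, ?_, fun w hw hH i => ?_⟩
  · have := Finset.sum_nonneg fun i (_ : i ∈ Finset.univ) => abs_nonneg (C i)
    linarith
  have h1 := hC i w (hbox _ _ w (Ω_subset_dom hw) hH fun i => Ioo_subset_Icc_self (hw.2.2.1 i))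
  have h2 := Finset.single_le_sum (fun i _ => abs_nonneg (C i)) (Finset.mem_univ i)
  linarith [le_abs_self (P.k w i), le_abs_self (C i)]

/-- Since `0 ≤ f`, the gain exceeds `Φ - G` by at least `μ₁`. Thus `F` is positive at small speeds
as long as `k` is bounded. -/
theorem F_ge (hP : P.Admissible) {w : State n} (hw : w ∈ P.dom) (i : Fin n) :
    P.Rin * P.ω * P.μ₁ - P.k w i * w.2.2.2 i ≤ P.F w i := by
  have hc := hP.cos_pos hw i
  have h2 := hP.le_f (-(P.vmax * Real.cos (w.2.2.1 i)
      / (P.vmax * Real.cos (w.2.2.1 i) - w.1 i * P.ω)) * (P.Phi w i - P.G w i))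
  have hf := (le_max_left _ _).trans h2
  have h1 : P.Rin * P.ω ≤ w.1 i * P.ω / Real.cos (w.2.2.1 i) := by
    rw [le_div_iff₀ hc]
    have : P.Rin * P.ω * Real.cos (w.2.2.1 i) ≤ P.Rin * P.ω * 1 :=
      mul_le_mul_of_nonneg_left (Real.cos_le_one _) (mul_pos hP.Rin_pos hP.ω_pos).le
    linarith [mul_lt_mul_of_pos_right (hw.1 i).1 hP.ω_pos]
  have h3 : P.F w i = w.1 i * P.ω / Real.cos (w.2.2.1 i)
      * (P.k w i - (P.Phi w i - P.G w i)) - P.k w i * w.2.2.2 i := by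
    unfold F
    ring
  rw [h3]
  refine sub_le_sub_right (mul_le_mul h1 ?_ hP.μ₁_pos.le
    ((mul_pos hP.Rin_pos hP.ω_pos).le.trans h1)) _
  unfold k
  linarith

/-- The argument of `f` is chosen so that, multiplied by `vmax - r ω / cos s`, it equals `-vmax (Φ -
G)`. With `x ≤ f x`, all terms in `Φ - G` then cancel, and `F` is negative at speeds near `vmax` as
long as `k` is bounded. -/
theorem F_le (hP : P.Admissible) {w : State n} (hw : w ∈ P.dom) (i : Fin n) :
    P.F w i ≤ P.k w i * (P.vmax - w.2.2.2 i)
      - P.μ₁ * (P.vmax - P.Rout * P.ω / Real.cos P.Θ) := by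
  have hc := hP.cos_pos hw i
  have hq := sub_pos.2 (hP.r_mul_ω_lt hw i)
  have h2 := (le_max_right _ _).trans (hP.le_f (-(P.vmax * Real.cos (w.2.2.1 i)
      / (P.vmax * Real.cos (w.2.2.1 i) - w.1 i * P.ω)) * (P.Phi w i - P.G w i)))
  have h1 : w.1 i * P.ω / Real.cos (w.2.2.1 i) ≤ P.Rout * P.ω / Real.cos P.Θ := by
    refine div_le_div₀ (mul_pos (hP.Rin_pos.trans hP.Rin_lt_Rout) hP.ω_pos).le
      (mul_lt_mul_of_pos_right (hw.1 i).2 hP.ω_pos).le hP.cos_Θ_pos (hP.cos_Θ_lt_cos (hw.2.1 i)).le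
  have h4 : 0 < P.vmax - w.1 i * P.ω / Real.cos (w.2.2.1 i) := by
    rw [sub_pos, div_lt_iff₀ hc]
    exact hP.r_mul_ω_lt hw i
  have h5 := mul_le_mul_of_nonneg_right h2 h4.le
  have h6 : -(P.vmax * Real.cos (w.2.2.1 i)
      / (P.vmax * Real.cos (w.2.2.1 i) - w.1 i * P.ω)) * (P.Phi w i - P.G w i)
      * (P.vmax - w.1 i * P.ω / Real.cos (w.2.2.1 i)) = -P.vmax * (P.Phi w i - P.G w i) := by
    field_simp
  have h7 := mul_le_mul_of_nonneg_left h1 hP.μ₁_pos.le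
  rw [h6] at h5
  have h3 : P.F w i = P.k w i * (P.vmax - w.2.2.2 i)
      - P.k w i * (P.vmax - w.1 i * P.ω / Real.cos (w.2.2.1 i))
      - w.1 i * P.ω / Real.cos (w.2.2.1 i) * (P.Phi w i - P.G w i) := by
    unfold F
    ring
  rw [h3]
  generalize hK : P.k w i * (P.vmax - w.2.2.2 i) = K
  unfold k
  linarith

theorem antitoneOn_H (hP : P.Admissible) {I : Set ℝ} (hI : Convex ℝ I) {w : ℝ → State n}
    (hw : SolvesIn P.field P.Ω I w) : AntitoneOn (fun t => P.H (w t)) I :=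
  antitoneOn_of_hasDerivWithinAt_nonpos (f' := fun t => P.Hdot (w t)) hI
    (fun t ht => (hasDerivWithinAt_H hP (hw t ht).2 (hw t ht).1).continuousWithinAt)
    (fun t ht => (hasDerivWithinAt_H hP (hw t (interior_subset ht)).2
      (hw t (interior_subset ht)).1).mono interior_subset)
    (fun t ht => Hdot_nonpos hP (Ω_subset_dom (hw t (interior_subset ht)).1))

/-- Along solutions the speeds stay away from `0` and `vmax`. -/
theorem exists_speed_bounds (hP : P.Admissible) {w₀ : State n} (hw₀ : w₀ ∈ P.Ω) :
    ∃ m₁ m₂ : Fin n → ℝ, (∀ i, 0 < m₁ i) ∧ (∀ i, m₂ i < P.vmax) ∧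
      ∀ (T : ℝ) (y : ℝ → State n), y 0 = w₀ → SolvesIn P.field P.Ω (Icc 0 T) y →
        ∀ t ∈ Icc 0 T, ∀ i, (y t).2.2.2 i ∈ Icc (m₁ i) (m₂ i) := by
  obtain ⟨C, hC, hk⟩ := exists_k_le hP (P.H w₀)
  have hlow : 0 < P.Rin * P.ω * P.μ₁ := mul_pos (mul_pos hP.Rin_pos hP.ω_pos) hP.μ₁_pos
  have hup : 0 < P.μ₁ * (P.vmax - P.Rout * P.ω / Real.cos P.Θ) := by
    refine mul_pos hP.μ₁_pos ?_
    rw [sub_pos, div_lt_iff₀ hP.cos_Θ_pos]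
    exact hP.Rout_mul_ω_lt
  -- Beyond these thresholds, `k ≤ C` lets the term with `k` use up at most half of the constant in
  -- `F_ge` or `F_le`, so `F` keeps its sign there.
  refine ⟨fun i => min (w₀.2.2.2 i) (P.Rin * P.ω * P.μ₁ / (2 * C)),
    fun i => max (w₀.2.2.2 i) (P.vmax - P.μ₁ * (P.vmax - P.Rout * P.ω / Real.cos P.Θ) / (2 * C)),
    fun i => lt_min (hw₀.2.2.1 i).1 (by positivity),
    fun i => max_lt (hw₀.2.2.1 i).2 (sub_lt_self _ (by positivity)), ?_⟩
  intro T y hy0 hy t ht i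
  have hH : ∀ τ ∈ Icc 0 T, P.H (y τ) ≤ P.H w₀ := fun τ hτ => by
    have := antitoneOn_H hP (convex_Icc 0 T) hy ⟨le_rfl, hτ.1.trans hτ.2⟩ hτ hτ.1
    simpa only [hy0] using this
  have hv : ∀ τ ∈ Ico 0 T, HasDerivWithinAt (fun τ => (y τ).2.2.2 i) (P.F (y τ) i) (Ici τ) τ :=
    fun τ hτ => hasDerivWithinAt_v (hy.hasDerivWithinAt_Ici hτ) i
  have hvc : ContinuousOn (fun τ => (y τ).2.2.2 i) (Icc 0 T) := fun τ hτ =>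
    (hasDerivWithinAt_v (hy τ hτ).2 i).continuousWithinAt
  constructor
  -- Barrier argument against a constant: whenever the speed equals the bound, its derivative points
  -- strictly inwards. The lower bound is treated through `-v`.
  · refine neg_le_neg_iff.1 (image_le_of_deriv_right_lt_deriv_boundary (B' := fun _ => 0) hvc.neg
      (fun τ hτ => (hv τ hτ).neg) ?_ (fun _ => hasDerivAt_const _ _) (fun τ hτ heq => ?_) ht)
    · simp [hy0]
    · have hτ' := Ico_subset_Icc_self hτ
      have hm : (y τ).2.2.2 i ≤ P.Rin * P.ω * P.μ₁ / (2 * C) :=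
        (neg_inj.1 heq).trans_le (min_le_right _ _)
      have hkC := mul_le_mul_of_nonneg_right (hk _ (hy τ hτ').1 (hH τ hτ') i)
        ((hy τ hτ').1.2.2.1 i).1.le
      have h1 := mul_le_mul_of_nonneg_left hm hC.le
      have h2 : C * (P.Rin * P.ω * P.μ₁ / (2 * C)) = P.Rin * P.ω * P.μ₁ / 2 := by field_simp
      linarith [F_ge hP (Ω_subset_dom (hy τ hτ').1) i]
  · refine image_le_of_deriv_right_lt_deriv_boundary (B' := fun _ => 0) hvc
      hv ?_ (fun _ => hasDerivAt_const _ _) (fun τ hτ heq => ?_) ht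
    · simp [hy0]
    · have hτ' := Ico_subset_Icc_self hτ
      have hm : P.vmax - (y τ).2.2.2 i
          ≤ P.μ₁ * (P.vmax - P.Rout * P.ω / Real.cos P.Θ) / (2 * C) := by
        have := (le_max_right (w₀.2.2.2 i) _).trans_eq heq.symm
        linarith
      have hkC := mul_le_mul_of_nonneg_right (hk _ (hy τ hτ').1 (hH τ hτ') i)
        (sub_pos.2 ((hy τ hτ').1.2.2.1 i).2).le
      have h1 := mul_le_mul_of_nonneg_left hm hC.le
      have h2 : C * (P.μ₁ * (P.vmax - P.Rout * P.ω / Real.cos P.Θ) / (2 * C))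
          = P.μ₁ * (P.vmax - P.Rout * P.ω / Real.cos P.Θ) / 2 := by
        rw [mul_div_assoc', mul_comm 2 C, mul_div_mul_left _ _ hC.ne']
      linarith [F_le hP (Ω_subset_dom (hy τ hτ').1) i]

/-- Every trajectory stays in a closed box inside the state space. -/
theorem exists_invariant_box (hP : P.Admissible) {w₀ : State n} (hw₀ : w₀ ∈ P.Ω) :
    ∃ (ρ₁ ρ₂ : Fin n → ℝ) (θ : ℝ) (ℓ : Fin n → Fin n → ℝ) (m₁ m₂ : Fin n → ℝ),
      P.box ρ₁ ρ₂ θ ℓ m₁ m₂ ⊆ P.Ω ∧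
      ∀ (T : ℝ) (y : ℝ → State n), y 0 = w₀ → SolvesIn P.field P.Ω (Icc 0 T) y →
        ∀ t ∈ Icc 0 T, y t ∈ P.box ρ₁ ρ₂ θ ℓ m₁ m₂ := by
  obtain ⟨ρ₁, ρ₂, θ, ℓ, hsub, hbox⟩ := exists_sublevel_subset_box hP (P.H w₀)
  obtain ⟨m₁, m₂, hm₁, hm₂, hm⟩ := exists_speed_bounds hP hw₀
  refine ⟨ρ₁, ρ₂, θ, ℓ, m₁, m₂, fun w hw => ?_, fun T y hy0 hy t ht => ?_⟩
  · obtain ⟨h1, h2, h3⟩ := hsub _ _ hw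
    exact ⟨h1, h2, fun i => ⟨(hm₁ i).trans_le (hw.2.2.1 i).1, (hw.2.2.1 i).2.trans_lt (hm₂ i)⟩, h3⟩
  · refine hbox _ _ _ (Ω_subset_dom (hy t ht).1) ?_ (hm T y hy0 hy t ht)
    have := antitoneOn_H hP (convex_Icc 0 T) hy ⟨le_rfl, ht.1.trans ht.2⟩ ht ht.1
    simpa only [hy0] using this

theorem abs_angSpeed_le (hP : P.Admissible) {w : State n} (hw : w ∈ P.Ω) (i : Fin n) :
    |angSpeed w i| ≤ P.vmax / P.Rin := by
  have hr := hP.r_pos (Ω_subset_dom hw) i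
  have hv : 0 < w.2.2.2 i ∧ w.2.2.2 i < P.vmax := hw.2.2.1 i
  rw [angSpeed, abs_mul, abs_of_pos (div_pos hv.1 hr)]
  refine (mul_le_of_le_one_right (div_pos hv.1 hr).le (Real.abs_cos_le_one _)).trans ?_
  exact div_le_div₀ hP.vmax_pos.le hv.2.le hP.Rin_pos (hw.1 i).1.le

/-- The invariant box does not limit the angles; the bound on the angular speed does so on `[0, T]`,
which yields the compact set required for continuation. -/
theorem exists_global_solution (hP : P.Admissible) {w₀ : State n} (hw₀ : w₀ ∈ P.Ω) :
    ∃ w : ℝ → State n, w 0 = w₀ ∧ SolvesIn P.field P.Ω (Ici 0) w := by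
  obtain ⟨ρ₁, ρ₂, θ, ℓ, m₁, m₂, hsub, hbox⟩ := exists_invariant_box hP hw₀
  refine SolvesIn.exists_Ici isOpen_Ω hP.contDiffOn_field hw₀ fun T =>
    ⟨_, isCompact_box_inter (fun i => w₀.2.1 i - P.vmax / P.Rin * T)
      (fun i => w₀.2.1 i + P.vmax / P.Rin * T), inter_subset_left.trans hsub,
      fun t ht y hy0 hy => ⟨hbox t y hy0 hy t ⟨ht.1, le_rfl⟩, fun i => ?_⟩⟩
  have h := (convex_Icc 0 t).norm_image_sub_le_of_norm_hasDerivWithin_le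
    (f := fun τ => (y τ).2.1 i) (C := P.vmax / P.Rin)
    (fun τ hτ => hasDerivWithinAt_φ (hy τ hτ).2 i)
    (fun τ hτ => abs_angSpeed_le hP (hy τ hτ).1 i) (left_mem_Icc.2 ht.1) (right_mem_Icc.2 ht.1)
  have h2 : P.vmax / P.Rin * t ≤ P.vmax / P.Rin * T :=
    mul_le_mul_of_nonneg_left ht.2 (div_pos hP.vmax_pos hP.Rin_pos).le
  simp only [hy0, sub_zero, Real.norm_eq_abs, abs_of_nonneg ht.1] at h
  have := abs_le.1 (h.trans h2)
  exact ⟨by linarith, by linarith⟩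

theorem field_shift (m : Fin n → ℤ) (w : State n) : P.field (shift m w) = P.field w := by
  simp only [field, F_shift, sdot_shift]
  rfl

/-- Continuous observables which are invariant under full turns are uniformly continuous along
trajectories. -/
theorem uniformContinuousOn_comp_solution (hP : P.Admissible) {w : ℝ → State n}
    (hw : SolvesIn P.field P.Ω (Ici 0) w) {g : State n → ℝ} (hg : ContinuousOn g P.Ω)
    (hinv : ∀ m w, g (shift m w) = g w) : UniformContinuousOn (fun t => g (w t)) (Ici 0) := by
  obtain ⟨ρ₁, ρ₂, θ, ℓ, m₁, m₂, hsub, hbox⟩ := exists_invariant_box hP (hw 0 self_mem_Ici).1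
  have hmem : MapsTo w (Ici 0) (P.box ρ₁ ρ₂ θ ℓ m₁ m₂) := fun t ht =>
    hbox t w rfl (hw.mono Icc_subset_Ici_self) t ⟨ht, le_rfl⟩
  obtain ⟨C, hC⟩ := exists_abs_le_of_shift hP.contDiffOn_field.continuousOn.norm hsub
    fun m w => by rw [field_shift]
  -- The field is bounded on the invariant box, modulo turns, so the trajectory is Lipschitz in
  -- time.
  have hlip : LipschitzOnWith C.toNNReal w (Ici 0) :=
    (convex_Ici 0).lipschitzOnWith_of_nnnorm_hasDerivWithin_le (fun t ht => (hw t ht).2)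
      fun t ht => by
        have := hC _ (hmem ht)
        rw [abs_norm] at this
        exact NNReal.coe_le_coe.1 (this.trans (Real.le_coe_toNNReal C))
  exact (uniformContinuousOn_of_shift hg hsub hinv).comp hlip.uniformContinuousOn hmem

theorem Hdot_shift (m : Fin n → ℤ) (w : State n) : P.Hdot (shift m w) = P.Hdot w := by
  simp only [Hdot, k_shift, G_shift, M_shift]
  rfl

theorem angAcc_shift (m : Fin n → ℤ) (w : State n) (i : Fin n) :
    P.angAcc (shift m w) i = P.angAcc w i := by
  simp only [angAcc, F_shift, sdot_shift]
  rfl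

/-! ### Limits as time tends to infinity. -/

section Asymptotics

variable {w : ℝ → State n}

theorem continuousOn_Hdot (hP : P.Admissible) : ContinuousOn P.Hdot P.Ω := by
  refine ContinuousOn.mono (continuousOn_finsetSum _ fun i _ => ?_) Ω_subset_dom
  have h1 := (hP.contDiffOn_k i).continuousOn
  have h2 := (hP.contDiffOn_G i).continuousOn
  have h3 := (hP.contDiffOn_M i).continuousOn
  have h4 := (hP.contDiffOn_angSpeed i).continuousOn
  fun_prop

theorem continuousOn_angAcc (hP : P.Admissible) (i : Fin n) :
    ContinuousOn (fun w => P.angAcc w i) P.Ω := by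
  have h1 := (hP.contDiffOn_F i).continuousOn.mono Ω_subset_dom
  have h2 := (hP.contDiffOn_sdot i).continuousOn
  have hr : ∀ w ∈ P.Ω, w.1 i ≠ 0 := fun w hw => (hP.r_pos (Ω_subset_dom hw) i).ne'
  unfold angAcc
  refine ContinuousOn.sub (ContinuousOn.add (ContinuousOn.mul (h1.div (by fun_prop) hr)
    (by fun_prop)) (ContinuousOn.div (by fun_prop) (by fun_prop) fun w hw =>
      pow_ne_zero 2 (hr w hw)))
    (ContinuousOn.mul (ContinuousOn.mul (ContinuousOn.div (by fun_prop) (by fun_prop) hr)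
      (by fun_prop)) h2)

theorem tendsto_Hdot (hP : P.Admissible) (hw : SolvesIn P.field P.Ω (Ici 0) w) :
    Tendsto (fun t => P.Hdot (w t)) atTop (𝓝 0) := by
  have hanti := antitoneOn_H hP (convex_Ici 0) hw
  -- Freezing time below `0` gives a function antitone on the whole line, bounded below by `0`, so
  -- `H` converges.
  have hmax : Antitone fun t => P.H (w (max t 0)) := fun s t hst =>
    hanti (le_max_right s 0) (le_max_right t 0) (max_le_max_right 0 hst)
  have hlim := tendsto_atTop_ciInf hmax ⟨0, by
    rintro _ ⟨t, rfl⟩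
    exact H_nonneg hP (Ω_subset_dom (hw _ (le_max_right t 0)).1)⟩
  have hlim' : Tendsto (fun t => P.H (w t)) atTop (𝓝 (⨅ t, P.H (w (max t 0)))) :=
    hlim.congr' (by
      filter_upwards [eventually_ge_atTop 0] with t ht
      rw [max_eq_left ht])
  exact tendsto_zero_of_hasDerivAt_of_uniformContinuousOn
    (fun t ht => (hasDerivWithinAt_H hP (hw t ht.le).2 (hw t ht.le).1).hasDerivAt
      (Ici_mem_nhds ht)) hlim'
    (uniformContinuousOn_comp_solution hP hw (continuousOn_Hdot hP) Hdot_shift)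

theorem tendsto_sq_zero (hP : P.Admissible) (hw : SolvesIn P.field P.Ω (Ici 0) w) (i : Fin n) :
    Tendsto (fun t => P.μ₁ * (angSpeed (w t) i - P.ω) ^ 2) atTop (𝓝 0) ∧
      Tendsto (fun t => P.μ₂ * Real.sin ((w t).2.2.1 i) ^ 2) atTop (𝓝 0) := by
  have hμ₁ := hP.μ₁_pos
  have hμ₂ := hP.μ₂_pos
  have hlim := (tendsto_Hdot hP hw).neg
  rw [neg_zero] at hlim
  have hle : ∀ᶠ t in atTop, P.μ₁ * (angSpeed (w t) i - P.ω) ^ 2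
      + P.μ₂ * Real.sin ((w t).2.2.1 i) ^ 2 ≤ -P.Hdot (w t) := by
    filter_upwards [eventually_ge_atTop 0] with t ht
    have h1 := Hdot_le hP (Ω_subset_dom (hw t ht).1)
    have h2 := Finset.single_le_sum (f := fun i => P.μ₁ * (angSpeed (w t) i - P.ω) ^ 2
      + P.μ₂ * Real.sin ((w t).2.2.1 i) ^ 2) (fun i _ => by positivity) (Finset.mem_univ i)
    linarith
  constructor
  · refine squeeze_zero' (.of_forall fun t => by positivity) (hle.mono fun t h => ?_) hlim
    have : 0 ≤ P.μ₂ * Real.sin ((w t).2.2.1 i) ^ 2 := by positivity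
    linarith
  · refine squeeze_zero' (.of_forall fun t => by positivity) (hle.mono fun t h => ?_) hlim
    have : 0 ≤ P.μ₁ * (angSpeed (w t) i - P.ω) ^ 2 := by positivity
    linarith

theorem tendsto_angSpeed (hP : P.Admissible) (hw : SolvesIn P.field P.Ω (Ici 0) w) (i : Fin n) :
    Tendsto (fun t => angSpeed (w t) i) atTop (𝓝 P.ω) := by
  have h := (tendsto_sq_zero hP hw i).1.const_mul P.μ₁⁻¹
  simp only [inv_mul_cancel_left₀ hP.μ₁_pos.ne', mul_zero] at h
  have h2 := tendsto_zero_of_sq h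
  simpa using h2.add_const P.ω

theorem tendsto_s (hP : P.Admissible) (hw : SolvesIn P.field P.Ω (Ici 0) w) (i : Fin n) :
    Tendsto (fun t => (w t).2.2.1 i) atTop (𝓝 0) := by
  have h := (tendsto_sq_zero hP hw i).2.const_mul P.μ₂⁻¹
  simp only [inv_mul_cancel_left₀ hP.μ₂_pos.ne', mul_zero] at h
  have h2 := tendsto_zero_of_sq h
  -- Since `|s| < Θ < π / 2`, the heading is recovered from its sine by `arcsin`.
  have h3 := (Real.continuous_arcsin.tendsto 0).comp h2
  rw [Real.arcsin_zero] at h3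
  refine h3.congr' ?_
  filter_upwards [eventually_ge_atTop 0] with t ht
  have hs : -P.Θ < (w t).2.2.1 i ∧ (w t).2.2.1 i < P.Θ := (hw t ht).1.2.1 i
  exact Real.arcsin_sin (by linarith [hP.Θ_lt]) (by linarith [hP.Θ_lt])

theorem tendsto_cos (hP : P.Admissible) (hw : SolvesIn P.field P.Ω (Ici 0) w) (i : Fin n) :
    Tendsto (fun t => Real.cos ((w t).2.2.1 i)) atTop (𝓝 1) := by
  have := (Real.continuous_cos.tendsto 0).comp (tendsto_s hP hw i)
  rwa [Real.cos_zero] at this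

theorem tendsto_v_div_r (hP : P.Admissible) (hw : SolvesIn P.field P.Ω (Ici 0) w) (i : Fin n) :
    Tendsto (fun t => (w t).2.2.2 i / (w t).1 i) atTop (𝓝 P.ω) := by
  have h := (tendsto_angSpeed hP hw i).div (tendsto_cos hP hw i) one_ne_zero
  rw [div_one] at h
  refine h.congr' ?_
  filter_upwards [eventually_ge_atTop 0] with t ht
  exact mul_div_cancel_right₀ _ (hP.cos_pos (Ω_subset_dom (hw t ht).1) i).ne'

theorem tendsto_sdot (hP : P.Admissible) (hw : SolvesIn P.field P.Ω (Ici 0) w) (i : Fin n) :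
    Tendsto (fun t => P.sdot (w t) i) atTop (𝓝 0) :=
  tendsto_zero_of_hasDerivAt_of_uniformContinuousOn
    (fun t ht => (hasDerivWithinAt_s (hw t ht.le).2 i).hasDerivAt (Ici_mem_nhds ht))
    (tendsto_s hP hw i)
    (uniformContinuousOn_comp_solution hP hw (hP.contDiffOn_sdot i).continuousOn
      fun m w => sdot_shift m w i)

/-- The angular acceleration tends to zero by Barbalat's lemma. It equals `F cos s / r` plus terms
that vanish with `sin s`, and `cos s` tends to `1` while `r` stays below `Rout`. -/
theorem tendsto_F (hP : P.Admissible) (hw : SolvesIn P.field P.Ω (Ici 0) w) (i : Fin n) :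
    Tendsto (fun t => P.F (w t) i) atTop (𝓝 0) := by
  have h1 : Tendsto (fun t => P.angAcc (w t) i) atTop (𝓝 0) :=
    tendsto_zero_of_hasDerivAt_of_uniformContinuousOn
      (fun t ht => (hasDerivWithinAt_angSpeed (hw t ht.le).2 hP (Ω_subset_dom (hw t ht.le).1)
        i).hasDerivAt (Ici_mem_nhds ht)) (tendsto_angSpeed hP hw i)
      (uniformContinuousOn_comp_solution hP hw (continuousOn_angAcc hP i)
        fun m w => angAcc_shift m w i)
  have hsin := (Real.continuous_sin.tendsto 0).comp (tendsto_s hP hw i)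
  rw [Real.sin_zero] at hsin
  have hcos := tendsto_cos hP hw i
  have hvr := tendsto_v_div_r hP hw i
  have h2 := ((h1.sub (((hvr.pow 2).mul hsin).mul hcos)).add
    ((hvr.mul hsin).mul (tendsto_sdot hP hw i))).div hcos one_ne_zero
  have h3 : Tendsto (fun t => P.F (w t) i / (w t).1 i) atTop (𝓝 0) := by
    have h0 : (0 - P.ω ^ 2 * 0 * 1 + P.ω * 0 * 0) / 1 = 0 := by ring
    rw [h0] at h2
    refine h2.congr' ?_
    filter_upwards [eventually_ge_atTop 0] with t ht
    have hr := (hP.r_pos (Ω_subset_dom (hw t ht).1) i).ne'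
    have hc := (hP.cos_pos (Ω_subset_dom (hw t ht).1) i).ne'
    rw [Pi.div_apply, div_eq_iff hc]
    simp only [angAcc, Function.comp_apply]
    ring
  have h4 := h3.abs.const_mul P.Rout
  rw [abs_zero, mul_zero] at h4
  refine squeeze_zero_norm' ?_ h4
  filter_upwards [eventually_ge_atTop 0] with t ht
  have hr := hP.r_pos (Ω_subset_dom (hw t ht).1) i
  have hR : (w t).1 i ≤ P.Rout := ((hw t ht).1.1 i).2.le
  rw [Real.norm_eq_abs, abs_div, abs_of_pos hr, mul_div_assoc', le_div_iff₀ hr, mul_comm]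
  exact mul_le_mul_of_nonneg_right hR (abs_nonneg _)

end Asymptotics

end Params

end RingRoad

/-! ### The main theorem. -/

theorem theorem1 {n : ℕ} (P : RingRoad.Params n) (hP : P.Admissible) :
    ∃ P₁ : ℝ → ℝ, MonotoneOn P₁ (Ici 0) ∧ MapsTo P₁ (Ici 0) (Ici 0) ∧
      ∀ w₀ ∈ P.Ω, ∃ w : ℝ → RingRoad.State n,
        (w 0 = w₀ ∧ P.IsSolutionOn (Ici 0) w) ∧
        (∀ T : ℝ, 0 < T → ∀ y : ℝ → RingRoad.State n,
          y 0 = w₀ → P.IsSolutionOn (Ico 0 T) y → EqOn y w (Ico 0 T)) ∧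
        (∀ i, Tendsto (fun t => (w t).s i) atTop (𝓝 0)) ∧
        (∀ i, Tendsto (fun t => (w t).v i / (w t).r i) atTop (𝓝 P.ω)) ∧
        (∀ i, Tendsto (deriv fun t => (w t).s i) atTop (𝓝 0)) ∧
        (∀ i, Tendsto (fun t => P.F (w t) i) atTop (𝓝 0)) ∧
        ∀ t, 0 ≤ t → ∀ i, |P.F (w t) i| + |P.δ (w t) i| ≤ P₁ (P.H w₀) := by
  -- The supremum of `|F|` over a sublevel set of `H` is automatically monotone in the level.
  -- Inserting `0` keeps the set nonempty and the supremum nonnegative, even if the sublevel set is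
  -- empty or `n = 0`. The steering angle, an arctangent, contributes at most `π / 2`.
  let S : ℝ → Set ℝ := fun h => insert 0 {x | ∃ w ∈ P.Ω, P.H w ≤ h ∧ ∃ i, x = |P.F w i|}
  have hbdd : ∀ h, BddAbove (S h) := fun h => by
    obtain ⟨C, hC⟩ := RingRoad.Params.exists_abs_F_le hP h
    refine BddAbove.insert 0 ⟨C, ?_⟩
    rintro _ ⟨w, hw, hH, i, rfl⟩
    exact hC w hw hH i
  refine ⟨fun h => sSup (S h) + Real.pi / 2, ?_, ?_, fun w₀ hw₀ => ?_⟩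
  · intro h _ h' _ hh
    refine add_le_add_left (csSup_le_csSup (hbdd h') (insert_nonempty _ _)
      (insert_subset_insert ?_)) _
    rintro x ⟨w, hw, hH, hx⟩
    exact ⟨w, hw, hH.trans hh, hx⟩
  · intro h _
    exact add_nonneg (le_csSup (hbdd h) (mem_insert _ _)) Real.pi_div_two_pos.le
  obtain ⟨w, hw0, hw⟩ := RingRoad.Params.exists_global_solution hP hw₀
  refine ⟨w, ⟨hw0, hP.isSolutionOn_iff.2 hw⟩, fun T _ y hy0 hy t ht => ?_,
    RingRoad.Params.tendsto_s hP hw, RingRoad.Params.tendsto_v_div_r hP hw, fun i => ?_,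
    RingRoad.Params.tendsto_F hP hw, fun t ht i => ?_⟩
  · exact ((hP.isSolutionOn_iff.1 hy).mono (Icc_subset_Ico_right ht.2)).eqOn_Icc
      RingRoad.Params.isOpen_Ω hP.contDiffOn_field (hw.mono Icc_subset_Ici_self)
      (hy0.trans hw0.symm) ⟨ht.1, le_rfl⟩
  · refine (RingRoad.Params.tendsto_sdot hP hw i).congr' ?_
    -- At time `0` only a one-sided derivative is known, so `deriv` is identified for positive
    -- times.
    filter_upwards [eventually_gt_atTop 0] with t ht
    exact ((RingRoad.Params.hasDerivWithinAt_s (hw t ht.le).2 i).hasDerivAt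
      (Ici_mem_nhds ht)).deriv.symm
  · refine add_le_add (le_csSup (hbdd _) (Or.inr ⟨w t, (hw t ht).1, ?_, i, rfl⟩)) ?_
    · rw [← hw0]
      exact RingRoad.Params.antitoneOn_H hP (convex_Ici 0) hw self_mem_Ici ht ht
    · exact abs_le.2 ⟨(Real.neg_pi_div_two_lt_arctan _).le, (Real.arctan_lt_pi_div_two _).le⟩
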